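/- Corollary 1 (Weaker Sufficient Conditions for System Identification). Let $\mathcal H$ be a linear system completely described by $K=\sum_{i=1}^{K_\tau}K_{\nu,i}$ triplets $(\tau_i,\nu_{ij},\alpha_{ij})$, $1\le i\le K_\tau$, $1\le j\le K_{\nu,i}$, where $K_\tau\ge 1$, all $K_{\nu,i}\ge 1$, the delays $\tau_i$ are distinct, for each $i$ the Doppler-shifts $\nu_{ij}$ are distinct, and $0\ne\alpha_{ij}\in\mathbb C$. Let $\mathcal T,\mathcal W$ be real numbers with $\mathcal W>0$, and put $p=2K_\tau$, $T=2\pi p/\mathcal W=4\pi K_\tau/\mathcal W$, $N=\lfloor \mathcal T/T\rfloor$. The input signal is $x(t)=\sum_{n=0}^{N-1}x_n\,g(t-nT)$ with $|x_n|>0$ for all $n$; $g\in L^2(\mathbb R)$ has unit energy, its Fourier transform $G(\omega)=\int g(t)e^{-j\omega t}dt$ vanishes for $|\omega|>\mathcal W/2$, and $|G|$ is bounded above and bounded away from zero a.e. on $\mathcal F=[-\pi p/T,\pi p/T]$. Assume * [A1] $(\tau_i,\nu_{ij})\in[0,\tau_{max}]\times[-\nu_{max}/2,\nu_{max}/2]$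 for all $i,j$; * [A2] $\tau_{max}<T$; * [A3] $\nu_{max}T<1$, and the Doppler modulation is constant over each pulse, so that the observed output is $$y(t)=\sum_{i=1}^{K_\tau}\sum_{n=0}^{N-1}a_i[n]\,g(t-\tau_i-nT),\qquad a_i[n]=\sum_{j=1}^{K_{\nu,i}}\alpha_{ij}x_n e^{j2\pi\nu_{ij}nT}.$$ Consider the following recovery procedure applied to $y$. (1) Pass $y$ through a low-pass filter $s^*(-t)$, $s\in L^2(\mathbb R)$, whose spectrum $S$ vanishes off $\mathcal F$ and has modulus bounded above and bounded away from zero a.e. on $\mathcal F$; sample at the times $2\pi n/\mathcal W=nT/p$, $n\in\mathbb Z$; split the samples into $p$ sequences $c_\ell[n]=\langle y,s(\cdot-nT-(\ell-1)T/p)\rangle$, $1\le\ell\le p$, with discrete-time Fourier transforms $C_\ell(\omega)=\sum_n c_\ell[n]e^{-j\omega nT}$ (in $L^2$). (2) For $0<\omega<2\pi/T$ form $\mathbf d(\omega)=\mathbf W(\omega)^{-1}\mathbf c(\omega)$, where $\mathbf c=(C_\ell)_\ell$ and $\mathbf W_{\ell m}(\omega)=e^{j\omega(\ell-1)T/p}\frac1T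 S^*(\omega+\frac{2\pi}Tm')G(\omega+\frac{2\pi}Tm')e^{j\frac{2\pi}p(\ell-1)m'}$, $m'=m-p/2-1$; let $\mathbf d[n]$ be the inverse discrete-time Fourier transform of $\mathbf d(\omega)$. (3) (Smoothed ESPRIT.) With $M=p/2$ and $\mathbf d_m[n]=(d_m[n],\dots,d_{m+M}[n])^T$ form $\overline{\mathbf R}=\frac1M\sum_{m=1}^M\sum_{n\in\mathbb Z}\mathbf d_m[n]\mathbf d_m^H[n]$; let $\hat K_\tau$ be its rank, $\mathbf E$ the matrix of the $\hat K_\tau$ singular vectors of $\overline{\mathbf R}$ for its nonzero singular values, and $\mathbf E_\uparrow$, $\mathbf E_\downarrow$ the matrix $\mathbf E$ without its first, respectively last, row. The estimated delays are $\hat\tau_i=-\frac{T}{2\pi}\arg\lambda_i\in[0,T)$ for the eigenvalues $\lambda_i$ of $\mathbf E_\downarrow^\dagger\mathbf E_\uparrow$. (4) With the Vandermonde matrix $\mathbf N_{mi}=e^{-j\frac{2\pi}Tm'\hat\tau_i}$, let $\hat a_i[n]$ be the inverse discrete-time Fourier transform of $e^{j\omega\hat\tau_i}(\mathbf N^\dagger\mathbf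 d(\omega))_i$, and put $\tilde a_i[n]=\hat a_i[n]/x_n$, $0\le n<N$. (5) (Annihilating filter.) For each $i$, let $q$ be a monic polynomial $q(z)=\sum_{l=0}^Lq_lz^l$ of least degree $L$ such that $\sum_{l=0}^L q_l\tilde a_i[n+l]=0$ for $0\le n<N-L$. For the roots $u_1,\dots,u_L$ of $q$ put $\hat\nu_{ij}=\arg(u_j)/(2\pi T)$ with $\arg\in(-\pi,\pi]$, and $\hat{\boldsymbol\alpha}_i=\mathbf R^\dagger\tilde{\mathbf a}_i$ with $\mathbf R_{nj}=e^{j2\pi\hat\nu_{ij}nT}$. Return the set of all triplets $(\hat\tau_i,\hat\nu_{ij},\hat\alpha_{ij})$. If the time–bandwidth product satisfies $$\mathcal T\mathcal W\ge 2\pi(K+1)^2,$$ then the procedure uniquely identifies $\mathcal H$: it runs to completion, and whichever choices it makes (singular vectors, order of eigenvalues and roots), the returned set is exactly $\{(\tau_i,\nu_{ij},\alpha_{ij})\}$. Moreover $K_\tau\max_iK_{\nu,i}\le (K+1)^2/4$. -/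

import Mathlib

open MeasureTheory Complex
open scoped FourierTransform ComplexConjugate

/-! ### Signals, Fourier transforms -/

/-- Finite-energy continuous-time signals, `L²(ℝ; ℂ)`. -/
abbrev Signal : Type := Lp ℂ 2 (volume : Measure ℝ)

/-- The continuous-time (`L²`) Fourier transform in angular frequency,
`X(ω) = ∫ x(t) e^{-jωt} dt` (Mathlib's transform uses the kernel `e^{-2πjξt}`). -/
noncomputable def angularFT (f : Signal) : ℝ → ℂ :=
  fun ω => (𝓕 f : Signal) (ω / (2 * Real.pi))

/-- Inverse discrete-time Fourier transform of a spectrum given on the period `(0, 2π/T)`: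
`a[n] = (T/2π) ∫_0^{2π/T} A(ω) e^{jωnT} dω`. -/
noncomputable def idtft (T : ℝ) (A : ℝ → ℂ) (n : ℤ) : ℂ :=
  ((T / (2 * Real.pi) : ℝ) : ℂ) *
    ∫ ω in Set.Ioo 0 (2 * Real.pi / T), A ω * exp (I * ((ω * n * T : ℝ) : ℂ))

/-- `A`, on the period `(0, 2π/T)`, is the discrete-time Fourier transform
`∑ a[n] e^{-jωnT}` (in the `L²` sense) of the sequence `a`: it is the square-integrable
function whose Fourier coefficients are `a`. -/
def IsDTFT (T : ℝ) (a : ℤ → ℂ) (A : ℝ → ℂ) : Prop :=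
  MemLp A 2 (volume.restrict (Set.Ioo 0 (2 * Real.pi / T))) ∧ ∀ n, a n = idtft T A n

/-! ### Parametric underspread linear systems -/

/-- A parametric linear system, completely described by the triplets
`(τ_i, ν_ij, α_ij)`, `i < Kτ`, `j < Kν i`: the delays are distinct, the Doppler-shifts of
each delay are distinct, and every triplet is active. -/
structure ParametricSystem where
  /-- number of distinct delays -/
  Kτ : ℕ
  /-- number of Doppler-shifts of each delay -/
  Kν : Fin Kτ → ℕ
  /-- delays -/
  τ : Fin Kτ → ℝ
  /-- Doppler-shifts -/
  ν : (i : Fin Kτ) → Fin (Kν i) → ℝ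
  /-- attenuation factors -/
  α : (i : Fin Kτ) → Fin (Kν i) → ℂ
  Kτ_pos : 0 < Kτ
  Kν_pos : ∀ i, 0 < Kν i
  τ_injective : Function.Injective τ
  ν_injective : ∀ i, Function.Injective (ν i)
  α_ne_zero : ∀ i j, α i j ≠ 0

namespace ParametricSystem

variable (H : ParametricSystem)

/-- Total number `K` of delay–Doppler pairs. -/
def K : ℕ := ∑ i, H.Kν i

/-- Maximal number of Doppler-shifts at one delay. -/
def KνMax : ℕ := Finset.univ.sup H.Kν

/-- The set of triplets that describes the system. -/
def triplets : Set (ℝ × ℝ × ℂ) :=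
  {q | ∃ i j, q = (H.τ i, H.ν i j, H.α i j)}

/-- The system lives in the delay–Doppler rectangle `[0, τmax] × [-νmax/2, νmax/2]`. -/
def InRectangle (τmax νmax : ℝ) : Prop :=
  ∀ i j, H.τ i ∈ Set.Icc 0 τmax ∧ H.ν i j ∈ Set.Icc (-(νmax / 2)) (νmax / 2)

/-- The sequences `a_i[n] = ∑_j α_ij x_n e^{j2πν_ij nT}`, `0 ≤ n < N`. -/
noncomputable def pulseCoeff (T : ℝ) {N : ℕ} (x : Fin N → ℂ) (i : Fin H.Kτ) (n : Fin N) : ℂ :=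
  ∑ j, H.α i j * x n * exp (I * ((2 * Real.pi * H.ν i j * (n : ℕ) * T : ℝ) : ℂ))

/-- The system output for the pulse train `x(t) = ∑_n x_n g(t - nT)`, in the narrowband
regime in which the Doppler modulation `e^{j2πν_ij t}` is constant, equal to
`e^{j2πν_ij nT}`, over the `n`-th pulse:
`y(t) = ∑_i ∑_n a_i[n] g(t - τ_i - nT)`. -/
noncomputable def output (g : Signal) (T : ℝ) {N : ℕ} (x : Fin N → ℂ) (t : ℝ) : ℂ :=
  ∑ i, ∑ n : Fin N, H.pulseCoeff T x i n * g (t - H.τ i - (n : ℕ) * T)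

end ParametricSystem

/-! ### Pulse and low-pass filter

The number of channels is even and is written `p = 2M` throughout. -/

/-- The working spectral band `[-πp/T, πp/T]`, `p = 2M`. -/
noncomputable def workingBand (T : ℝ) (M : ℕ) : Set ℝ :=
  Set.Icc (-(Real.pi / T * (2 * M : ℕ))) (Real.pi / T * (2 * M : ℕ))

/-- The modulus of the spectrum of `f` lies between two positive constants on the
working band. -/
def BoundedOnBand (f : Signal) (T : ℝ) (M : ℕ) : Prop :=
  ∃ a b : ℝ, 0 < a ∧
    ∀ᵐ ω, ω ∈ workingBand T M → a ≤ ‖angularFT f ω‖ ∧ ‖angularFT f ω‖ ≤ b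

/-- A unit-energy prototype pulse of two-sided bandwidth `W` whose spectrum is bounded above
and away from zero on the working band. -/
def IsPulse (g : Signal) (W T : ℝ) (M : ℕ) : Prop :=
  (∫ t, ‖g t‖ ^ 2 = 1) ∧ (∀ᵐ ω, W / 2 < |ω| → angularFT g ω = 0) ∧ BoundedOnBand g T M

/-- The kernel `s` of a low-pass filter `s*(-t)`: its spectrum vanishes off the working band
and is bounded above and away from zero on it. -/
def IsLowPass (s : Signal) (T : ℝ) (M : ℕ) : Prop :=
  (∀ᵐ ω, ω ∉ workingBand T M → angularFT s ω = 0) ∧ BoundedOnBand s T M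

/-! ### The sampling stage -/

/-- The output of the low-pass filter with impulse response `s*(-t)`, at time `t`:
`⟨y, s(· - t)⟩`. -/
noncomputable def filterOutput (s : Signal) (y : ℝ → ℂ) (t : ℝ) : ℂ :=
  ∫ u, y u * conj (s (u - t))

/-- The filter output is sampled at the times `2πn/W`, and the samples are split by a
serial-to-parallel converter into `p = 2M` subsequences
`c_ℓ[n]` (channels are numbered from `0`). -/
noncomputable def channel (s : Signal) (W : ℝ) (M : ℕ) (y : ℝ → ℂ) (l : Fin (2 * M)) (n : ℤ) : ℂ :=
  filterOutput s y (2 * Real.pi * ((n * (2 * M : ℕ) + (l : ℕ) : ℤ) : ℝ) / W)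

/-- The `p × p` matrix `W(e^{jωT})`, `ω ∈ (0, 2π/T)`, with entries
`e^{jωℓT/p} (1/T) S*(ω + 2πm'/T) G(ω + 2πm'/T) e^{j2πℓm'/p}`, where `m' = m - p/2`
(rows and columns are numbered from `0`). -/
noncomputable def correctionMatrix (g s : Signal) (T : ℝ) (M : ℕ) (ω : ℝ) :
    Matrix (Fin (2 * M)) (Fin (2 * M)) ℂ :=
  Matrix.of fun l m =>
    exp (I * ((ω * (l : ℕ) * T / (2 * M : ℕ) : ℝ) : ℂ)) * ((1 / T : ℝ) : ℂ) *
      conj (angularFT s (ω + 2 * Real.pi / T * ((m : ℕ) - M))) *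
      angularFT g (ω + 2 * Real.pi / T * ((m : ℕ) - M)) *
      exp (I * ((2 * Real.pi / (2 * M : ℕ) * (l : ℕ) * ((m : ℕ) - M) : ℝ) : ℂ))

/-- The spectrum `d(e^{jωT}) = W(e^{jωT})⁻¹ c(e^{jωT})` of the modified measurements. -/
noncomputable def correctedSpectrum (g s : Signal) (T : ℝ) (M : ℕ)
    (C : Fin (2 * M) → ℝ → ℂ) (ω : ℝ) : Fin (2 * M) → ℂ :=
  (correctionMatrix g s T M ω)⁻¹.mulVec fun l => C l ω

/-! ### The recovery stage -/

/-- `P` is the Moore–Penrose pseudoinverse of `A`. -/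
def IsMoorePenrose {m n : ℕ} (A : Matrix (Fin m) (Fin n) ℂ) (P : Matrix (Fin n) (Fin m) ℂ) : Prop :=
  A * P * A = A ∧ P * A * P = P ∧ (A * P).IsHermitian ∧ (P * A).IsHermitian

/-- The smoothed correlation matrix `(1/M) ∑_m ∑_n d_m[n] d_m[n]ᴴ` of the `M` subvectors
`d_m[n] = (d_m[n], …, d_{m+M}[n])`, `0 ≤ m < M`. -/
noncomputable def smoothedCorrelation (M : ℕ) (d : Fin (2 * M) → ℤ → ℂ) :
    Matrix (Fin (M + 1)) (Fin (M + 1)) ℂ :=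
  Matrix.of fun k l => (1 / (M : ℂ)) * ∑ m : Fin M, ∑' n : ℤ,
    d ⟨m + k, by omega⟩ n * conj (d ⟨m + l, by omega⟩ n)

/-- The columns of `E` are the (left) singular vectors of `R` that belong to its nonzero
singular values, in some singular value decomposition `R = U diag(σ) Vᴴ`. -/
def IsSignalSubspace {k r : ℕ} (R : Matrix (Fin k) (Fin k) ℂ) (E : Matrix (Fin k) (Fin r) ℂ) :
    Prop :=
  ∃ (U V : Matrix (Fin k) (Fin k) ℂ) (σ : Fin k → ℝ) (e : Fin r ↪ Fin k),
    U ∈ Matrix.unitaryGroup (Fin k) ℂ ∧ V ∈ Matrix.unitaryGroup (Fin k) ℂ ∧ (∀ a, 0 ≤ σ a) ∧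
    R = U * Matrix.diagonal (fun a => (σ a : ℂ)) * V.conjTranspose ∧
    Set.range e = {a | σ a ≠ 0} ∧ E = U.submatrix id e

/-- The delay recovery algorithm (ESPRIT with smoothing), run on the modified measurements
`d`, may return the `r` delays `τ`. With `E↓` (`E↑`) the matrix `E` without its last
(first) row, the delays are `-(T/2π) arg λ_i` for the eigenvalues `λ_i` of `E↓† E↑`, with
the branch of the argument for which they lie in `[0, T)`. -/
def IsDelayEstimate (T : ℝ) (M : ℕ) (d : Fin (2 * M) → ℤ → ℂ) (r : ℕ) (τ : Fin r → ℝ) : Prop :=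
  r = (smoothedCorrelation M d).rank ∧
  ∃ (E : Matrix (Fin (M + 1)) (Fin r) ℂ) (P : Matrix (Fin r) (Fin M) ℂ) (ev : Fin r → ℂ),
    IsSignalSubspace (smoothedCorrelation M d) E ∧
    IsMoorePenrose (E.submatrix Fin.castSucc id) P ∧
    (P * E.submatrix Fin.succ id).charpoly.roots = Finset.univ.val.map ev ∧
    ∀ i, τ i ∈ Set.Ico 0 T ∧
      ∃ k : ℤ, τ i = -(T / (2 * Real.pi)) * (arg (ev i) + 2 * Real.pi * k)

/-- The `p × r` Vandermonde matrix `N(τ)` with entries `e^{-j(2π/T)m'τ_i}`, `m' = m - p/2`,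
`p = 2M`. -/
noncomputable def delayMatrix (T : ℝ) (M : ℕ) {r : ℕ} (τ : Fin r → ℝ) :
    Matrix (Fin (2 * M)) (Fin r) ℂ :=
  Matrix.of fun m i => exp (-I * ((2 * Real.pi / T * ((m : ℕ) - M) * τ i : ℝ) : ℂ))

/-- The sequence `a_i[n]` recovered from the spectrum `d`, the delays `τ` and the
pseudoinverse `P` of `N(τ)`: its spectrum is the `i`-th entry of `D(τ)⁻¹ N(τ)† d`, where
`D(τ)` is diagonal with entries `e^{-jωτ_i}`. -/
noncomputable def recoveredCoeff (T : ℝ) (M : ℕ) {r : ℕ} (D : ℝ → Fin (2 * M) → ℂ)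
    (τ : Fin r → ℝ) (P : Matrix (Fin r) (Fin (2 * M)) ℂ) (i : Fin r) (n : ℤ) : ℂ :=
  idtft T (fun ω => exp (I * ((ω * τ i : ℝ) : ℂ)) * P.mulVec (D ω) i) n

/-- The filter with coefficients `q_0, …, q_L`, `L = deg q`, annihilates the finite sequence
`b`: `∑_l q_l b[n + l] = 0` whenever all indices involved are in range. -/
def Annihilates {N : ℕ} (q : Polynomial ℂ) (b : Fin N → ℂ) : Prop :=
  ∀ (n : ℕ) (h : n + q.natDegree < N),
    ∑ l : Fin (q.natDegree + 1), q.coeff l * b ⟨n + l, by omega⟩ = 0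

/-- `q` is an annihilating filter of `b` of least order. -/
def IsAnnihilatingFilter {N : ℕ} (q : Polynomial ℂ) (b : Fin N → ℂ) : Prop :=
  q.Monic ∧ Annihilates q b ∧
    ∀ q' : Polynomial ℂ, q'.Monic → Annihilates q' b → q.natDegree ≤ q'.natDegree

/-- The `N × L` Vandermonde matrix `R(ν)` with entries `e^{j2πν_j nT}`. -/
noncomputable def dopplerMatrix (T : ℝ) (N : ℕ) {L : ℕ} (ν : Fin L → ℝ) :
    Matrix (Fin N) (Fin L) ℂ :=
  Matrix.of fun n j => exp (I * ((2 * Real.pi * ν j * (n : ℕ) * T : ℝ) : ℂ))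

/-- The annihilating-filter method, run on the sequence `b`, may return the `L`
Doppler-shifts `ν` and the attenuation factors `α`: the shifts are `arg u_j / (2πT)` for the
roots `u_j` of the annihilating filter, and `α = R(ν)† b`. -/
def IsDopplerEstimate (T : ℝ) {N : ℕ} (b : Fin N → ℂ) (L : ℕ) (ν : Fin L → ℝ) (α : Fin L → ℂ) :
    Prop :=
  (∃ (q : Polynomial ℂ) (u : Fin L → ℂ), IsAnnihilatingFilter q b ∧
    q.roots = Finset.univ.val.map u ∧ ∀ j, ν j = arg (u j) / (2 * Real.pi * T)) ∧
  ∃ P : Matrix (Fin L) (Fin N) ℂ, IsMoorePenrose (dopplerMatrix T N ν) P ∧ α = P.mulVec b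

/-- The recovery procedure, run on the observation `y`, may return the set `S` of triplets.
Known to the procedure are the pulse `g`, the filter `s`, the sampling rate `W/2π`, the pulse
period `T`, the number `p = 2M` of channels and the probing sequence `x`. (The singular value
decomposition and the order of the eigenvalues and of the roots are free choices of a run.) -/
def ProcedureReturns (g s : Signal) (W T : ℝ) (M : ℕ) {N : ℕ} (x : Fin N → ℂ) (y : ℝ → ℂ)
    (S : Set (ℝ × ℝ × ℂ)) : Prop :=
  ∃ C : Fin (2 * M) → ℝ → ℂ,
    (∀ l, IsDTFT T (channel s W M y l) (C l)) ∧
    ∃ (r : ℕ) (τ : Fin r → ℝ),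
      IsDelayEstimate T M
        (fun l n => idtft T (fun ω => correctedSpectrum g s T M C ω l) n) r τ ∧
      ∃ P : Matrix (Fin r) (Fin (2 * M)) ℂ,
        IsMoorePenrose (delayMatrix T M τ) P ∧
        ∃ (L : Fin r → ℕ) (ν : (i : Fin r) → Fin (L i) → ℝ) (α : (i : Fin r) → Fin (L i) → ℂ),
          (∀ i, IsDopplerEstimate T
            (fun n : Fin N =>
              recoveredCoeff T M (correctedSpectrum g s T M C) τ P i ((n : ℕ) : ℤ) / x n)
            (L i) (ν i) (α i)) ∧
          S = {q | ∃ i j, q = (τ i, ν i j, α i j)}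

/-!
# Identification of a parametric system by sampling, ESPRIT and annihilating filters

Write `z_i = e^{-j2πτ_i/T}` for the nodes of the delays and `w_ij = e^{j2πν_ij T}` for those of the
Doppler-shifts. The footprint assumptions `τ_i ∈ [0, T)` and `|ν_ij T| < 1/2` say that each
parameter is determined by its node, so distinct parameters have distinct nodes. Every step then
rests on one fact, `eq_zero_of_sum_mul_pow_eq_zero`: `L` geometric sequences with distinct ratios
are linearly independent on any `L` consecutive indices.

* *Sampling.* By Plancherel's formula for translates (`integral_translate_mul_conj`), folded onto
  one period (`integral_fold`), the channels have the spectra `W(ω) d(ω)`, where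
  `d_m(ω) = ∑_i z_i^{m'} e^{-jωτ_i} A_i(ω)` and `A_i` is the spectrum of the sequence `a_i`
  (`channel_eq_idtft`). Since `W(ω)` is a discrete Fourier matrix between diagonal matrices with
  nonzero entries, it is invertible almost everywhere, and by Parseval the channels determine
  their spectra; hence the procedure computes `d` (`correctedSpectrum_ae_eq`).
* *Delays.* The smoothed correlation matrix is `V G Vᴴ` with `V` the Vandermonde matrix of the
  `z_i` and `G` positive definite (`smoothedGram_posDef`). So its signal subspace is the column
  space of `V`, and rotational invariance of `V` gives a matrix similar to `diag(z_i)`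
  (`isDelayEstimate_iff`).
* *Dopplers.* Inverting the Vandermonde matrix of the delays returns `a_i` (`recoveredCoeff_eq`),
  and `a_i[n] / x_n` is a sum of `Kν,i` exponentials. When `N ≥ 2 Kν,i` its minimal annihilating
  filter has exactly the roots `w_ij` (`isAnnihilatingFilter_iff`, `isDopplerEstimate_iff`).

The time–bandwidth condition enters only through `N ≥ 2 max_i Kν,i`, by
`4 Kτ max_i Kν,i ≤ (K + 1)²` (`four_mul_Kτ_mul_KνMax_le`).
-/

/-! ### Linear algebra -/

theorem exists_equiv_of_map_univ_eq {ι κ X : Type*} [Fintype ι] [Fintype κ] {u : ι → X} {w : κ → X}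
    (hw : Function.Injective w)
    (h : (Finset.univ : Finset ι).val.map u = (Finset.univ : Finset κ).val.map w) :
    ∃ e : ι ≃ κ, u = w ∘ e := by
  have hu : Function.Injective u := by
    have hn : ((Finset.univ : Finset ι).val.map u).Nodup := by
      rw [h]; exact (Multiset.nodup_map_iff_of_injective hw).2 Finset.univ.nodup
    intro a b hab
    exact Multiset.inj_on_of_nodup_map hn a (Finset.mem_univ a) b (Finset.mem_univ b) hab
  have h1 : ∀ i, ∃ k, w k = u i := by
    intro i
    have : u i ∈ (Finset.univ : Finset κ).val.map w := by
      rw [← h]; exact Multiset.mem_map_of_mem _ (Finset.mem_univ i)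
    obtain ⟨k, -, hk⟩ := Multiset.mem_map.1 this
    exact ⟨k, hk⟩
  choose f hf using h1
  have hfi : Function.Injective f := fun a b hab => hu (by rw [← hf, ← hf, hab])
  have hcard : Fintype.card ι = Fintype.card κ := by
    simpa using congrArg Multiset.card h
  refine ⟨Equiv.ofBijective f ((Fintype.bijective_iff_injective_and_card f).2 ⟨hfi, hcard⟩), ?_⟩
  funext i
  simp [hf]

theorem map_univ_comp_equiv {ι κ X : Type*} [Fintype ι] [Fintype κ] (w : κ → X) (e : ι ≃ κ) :
    (Finset.univ : Finset ι).val.map (w ∘ e) = (Finset.univ : Finset κ).val.map w := by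
  rw [← Multiset.map_map]
  congr 1
  simp

/-- Geometric sequences with distinct ratios are linearly independent, already on as many
terms as there are sequences. -/
theorem eq_zero_of_sum_mul_pow_eq_zero {L : ℕ} {w : Fin L → ℂ} (hw : Function.Injective w)
    {c : Fin L → ℂ} (h : ∀ n < L, ∑ j, c j * w j ^ n = 0) : c = 0 :=
  Matrix.eq_zero_of_forall_pow_sum_mul_pow_eq_zero hw fun i => h i i.2

/-- As soon as `A` has a left inverse, every Moore–Penrose inverse of `A` is one. -/
theorem IsMoorePenrose.mul_eq_one {m n : ℕ} {A : Matrix (Fin m) (Fin n) ℂ}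
    {P Q : Matrix (Fin n) (Fin m) ℂ} (hP : IsMoorePenrose A P) (hQ : Q * A = 1) : P * A = 1 := by
  have := congrArg (Q * ·) hP.1
  simpa only [← Matrix.mul_assoc, hQ, Matrix.one_mul] using this

open scoped ComplexOrder in
/-- A matrix `A` with trivial kernel has the Moore–Penrose inverse `(Aᴴ A)⁻¹ Aᴴ`, which is a
left inverse. -/
theorem exists_isMoorePenrose {m n : ℕ} {A : Matrix (Fin m) (Fin n) ℂ}
    (hA : Function.Injective A.mulVec) :
    ∃ P, IsMoorePenrose A P ∧ P * A = 1 := by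
  have hpd : (A.conjTranspose * A).PosDef := Matrix.PosDef.conjTranspose_mul_self A hA
  have hdet : IsUnit (A.conjTranspose * A).det := (Matrix.isUnit_iff_isUnit_det _).1 hpd.isUnit
  have h1 : (A.conjTranspose * A)⁻¹ * A.conjTranspose * A = 1 := by
    rw [Matrix.mul_assoc, Matrix.nonsing_inv_mul _ hdet]
  refine ⟨(A.conjTranspose * A)⁻¹ * A.conjTranspose, ⟨?_, ?_, ?_, ?_⟩, h1⟩
  · rw [Matrix.mul_assoc, h1, Matrix.mul_one]
  · rw [h1, Matrix.one_mul]
  · rw [← Matrix.mul_assoc]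
    exact Matrix.isHermitian_mul_mul_conjTranspose A hpd.isHermitian.inv
  · rw [h1]; exact Matrix.isHermitian_one

/-! ### Annihilating filters -/

/-- Filtering a sum of exponentials multiplies the amplitude of `w_j^n` by `q(w_j)`. -/
theorem annihilates_iff {N L : ℕ} {w α : Fin L → ℂ} {b : Fin N → ℂ}
    (hb : ∀ n : Fin N, b n = ∑ j, α j * w j ^ (n : ℕ)) (q : Polynomial ℂ) :
    Annihilates q b ↔
      ∀ n : ℕ, n + q.natDegree < N → ∑ j, (α j * q.eval (w j)) * w j ^ n = 0 := by
  unfold Annihilates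
  refine forall_congr' fun n => forall_congr' fun h => ?_
  have : ∑ l : Fin (q.natDegree + 1), q.coeff l * b ⟨n + l, by omega⟩
      = ∑ j, (α j * q.eval (w j)) * w j ^ n := by
    simp only [hb, Finset.mul_sum]
    rw [Finset.sum_comm]
    refine Finset.sum_congr rfl fun j _ => ?_
    rw [Polynomial.eval_eq_sum_range, Finset.mul_sum, Finset.sum_mul,
      ← Fin.sum_univ_eq_sum_range (fun l => α j * (q.coeff l * w j ^ l) * w j ^ n)]
    refine Finset.sum_congr rfl fun l _ => ?_
    rw [pow_add]; ring
  rw [this]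

/-- The minimal annihilating filter of a sum of `L` exponentials, observed at `N ≥ 2L` times,
is the monic polynomial with simple roots at the ratios `w_j`. -/
theorem isAnnihilatingFilter_iff {N L : ℕ} (hN : 2 * L ≤ N) {w α : Fin L → ℂ}
    (hw : Function.Injective w) (hα : ∀ j, α j ≠ 0) {b : Fin N → ℂ}
    (hb : ∀ n : Fin N, b n = ∑ j, α j * w j ^ (n : ℕ)) (q : Polynomial ℂ) :
    IsAnnihilatingFilter q b ↔ q = ∏ j, (Polynomial.X - Polynomial.C (w j)) := by
  have hdeg : (∏ j, (Polynomial.X - Polynomial.C (w j))).natDegree = L := by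
    simp [Polynomial.natDegree_finsetProd_X_sub_C_eq_card]
  have hmon : (∏ j, (Polynomial.X - Polynomial.C (w j))).Monic :=
    Polynomial.monic_prod_of_monic _ _ fun j _ => Polynomial.monic_X_sub_C _
  have hann : Annihilates (∏ j, (Polynomial.X - Polynomial.C (w j))) b := by
    rw [annihilates_iff hb]
    intro n _
    refine Finset.sum_eq_zero fun j _ => ?_
    rw [Polynomial.eval_prod, Finset.prod_eq_zero (Finset.mem_univ j) (by simp)]
    simp
  -- an annihilating filter of degree at most `L` leaves `N - L ≥ L` equations, which force it to
  -- vanish at every `w_j`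
  have key : ∀ q' : Polynomial ℂ, q'.Monic → Annihilates q' b → q'.natDegree ≤ L →
      q' = ∏ j, (Polynomial.X - Polynomial.C (w j)) := by
    intro q' hq' ha hle
    have h0 : (fun j => α j * q'.eval (w j)) = 0 :=
      eq_zero_of_sum_mul_pow_eq_zero hw fun n hn =>
        (annihilates_iff hb q').1 ha n (by omega)
    have hroot : ∀ j, q'.eval (w j) = 0 := fun j =>
      (mul_eq_zero.1 (congrFun h0 j)).resolve_left (hα j)
    have hdvd : (∏ j, (Polynomial.X - Polynomial.C (w j))) ∣ q' := by
      refine Finset.prod_dvd_of_coprime ?_ fun j _ => Polynomial.dvd_iff_isRoot.2 (hroot j)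
      exact fun i _ j _ hij => Polynomial.pairwise_coprime_X_sub_C hw hij
    exact (Polynomial.eq_of_monic_of_dvd_of_natDegree_le hmon hq' hdvd (by rw [hdeg]; exact hle))
  constructor
  · rintro ⟨hq, ha, hmin⟩
    exact key q hq ha (by simpa [hdeg] using hmin _ hmon hann)
  · rintro rfl
    refine ⟨hmon, hann, fun q' hq' ha => ?_⟩
    by_contra hlt
    have := key q' hq' ha (by omega)
    rw [this] at hlt
    exact hlt le_rfl

theorem roots_prod_X_sub_C_univ {L : ℕ} (w : Fin L → ℂ) :
    (∏ j, (Polynomial.X - Polynomial.C (w j))).roots = Finset.univ.val.map w := by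
  have := Polynomial.roots_multiset_prod_X_sub_C ((Finset.univ : Finset (Fin L)).val.map w)
  rwa [Multiset.map_map] at this

/-! ### Doppler-shifts and attenuation factors -/

/-- Doppler-shifts with `|ν T| < 1/2` are not aliased by the principal argument. -/
theorem arg_exp_div_eq {T ν : ℝ} (hT : 0 < T) (h : |ν * T| < 1 / 2) :
    arg (exp (I * ((2 * Real.pi * ν * T : ℝ) : ℂ))) / (2 * Real.pi * T) = ν := by
  have hpi := Real.pi_pos
  obtain ⟨h1, h2⟩ := abs_lt.1 h
  rw [mul_comm, Complex.arg_exp_mul_I, (toIocMod_eq_self _).2]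
  · field_simp
  · constructor <;> nlinarith

theorem dopplerMatrix_apply (T : ℝ) (N : ℕ) {L : ℕ} (ν : Fin L → ℝ) (n : Fin N) (j : Fin L) :
    dopplerMatrix T N ν n j = exp (I * ((2 * Real.pi * ν j * T : ℝ) : ℂ)) ^ (n : ℕ) := by
  rw [← Complex.exp_nat_mul]
  simp only [dopplerMatrix, Matrix.of_apply]
  congr 1; push_cast; ring

theorem injective_mulVec_of_pow {N L : ℕ} (hN : L ≤ N) {w : Fin L → ℂ}
    (hw : Function.Injective w) {A : Matrix (Fin N) (Fin L) ℂ}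
    (hA : ∀ n j, A n j = w j ^ (n : ℕ)) : Function.Injective A.mulVec := by
  rw [← Matrix.coe_mulVecLin, ← LinearMap.ker_eq_bot, LinearMap.ker_eq_bot']
  intro v hv
  refine eq_zero_of_sum_mul_pow_eq_zero hw fun n hn => ?_
  have := congrFun hv ⟨n, by omega⟩
  simpa [Matrix.mulVec, dotProduct, hA, mul_comm] using this

/-- From `N ≥ 2L` samples of a sum of `L` exponentials, the annihilating-filter method returns
the true shifts and amplitudes, in an arbitrary order. -/
theorem isDopplerEstimate_iff {T : ℝ} (hT : 0 < T) {N L : ℕ} (hN : 2 * L ≤ N)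
    {ν : Fin L → ℝ} {α : Fin L → ℂ} (hν : Function.Injective ν) (hνT : ∀ j, |ν j * T| < 1 / 2)
    (hα : ∀ j, α j ≠ 0) {b : Fin N → ℂ}
    (hb : ∀ n : Fin N, b n = ∑ j, α j * exp (I * ((2 * Real.pi * ν j * T : ℝ) : ℂ)) ^ (n : ℕ))
    {L' : ℕ} (ν' : Fin L' → ℝ) (α' : Fin L' → ℂ) :
    IsDopplerEstimate T b L' ν' α' ↔ ∃ e : Fin L' ≃ Fin L, ν' = ν ∘ e ∧ α' = α ∘ e := by
  set w : Fin L → ℂ := fun j => exp (I * ((2 * Real.pi * ν j * T : ℝ) : ℂ)) with hwdef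
  have harg : ∀ j, arg (w j) / (2 * Real.pi * T) = ν j := fun j => arg_exp_div_eq hT (hνT j)
  have hw : Function.Injective w := fun i j hij => hν (by rw [← harg, ← harg, hij])
  -- the amplitude step, once the shifts are known up to order
  have amp : ∀ e : Fin L' ≃ Fin L, ∃ P, IsMoorePenrose (dopplerMatrix T N (ν ∘ e)) P ∧
      ∀ P, IsMoorePenrose (dopplerMatrix T N (ν ∘ e)) P → P.mulVec b = α ∘ e := by
    intro e
    have hinj : Function.Injective (dopplerMatrix T N (ν ∘ e)).mulVec := by
      refine injective_mulVec_of_pow (w := w ∘ e) ?_ (hw.comp e.injective) fun n j => ?_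
      · have : L' = L := by simpa using Fintype.card_congr e
        omega
      · rw [dopplerMatrix_apply]; rfl
    obtain ⟨Q, hQ, hQ1⟩ := exists_isMoorePenrose hinj
    refine ⟨Q, hQ, fun P hP => ?_⟩
    have hbe : b = (dopplerMatrix T N (ν ∘ e)).mulVec (α ∘ e) := by
      funext n
      rw [hb, Matrix.mulVec, dotProduct, ← Equiv.sum_comp e]
      refine Finset.sum_congr rfl fun j _ => ?_
      rw [dopplerMatrix_apply, mul_comm]; rfl
    rw [hbe, Matrix.mulVec_mulVec, hP.mul_eq_one hQ1, Matrix.one_mulVec]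
  constructor
  · rintro ⟨⟨q, u, hq, hroots, hνu⟩, P, hP, rfl⟩
    rw [isAnnihilatingFilter_iff hN hw hα hb] at hq
    rw [hq, roots_prod_X_sub_C_univ] at hroots
    obtain ⟨e, rfl⟩ := exists_equiv_of_map_univ_eq hw hroots.symm
    have hν' : ν' = ν ∘ e := funext fun j => by rw [hνu]; exact harg _
    subst hν'
    exact ⟨e, rfl, (amp e).choose_spec.2 P hP⟩
  · rintro ⟨e, rfl, rfl⟩
    obtain ⟨P, hP, hPα⟩ := amp e
    refine ⟨⟨_, w ∘ e, (isAnnihilatingFilter_iff hN hw hα hb _).2 rfl, ?_, fun j => ?_⟩,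
      P, hP, (hPα P hP).symm⟩
    · rw [roots_prod_X_sub_C_univ, map_univ_comp_equiv]
    · exact (harg _).symm

/-! ### Delay estimation (ESPRIT with smoothing) -/

theorem summable_mul_conj {u v : ℤ → ℂ} (hu : Summable fun n => ‖u n‖ ^ 2)
    (hv : Summable fun n => ‖v n‖ ^ 2) : Summable fun n => u n * conj (v n) := by
  refine Summable.of_norm_bounded (hu.add hv) fun n => ?_
  rw [norm_mul, RCLike.norm_conj]
  nlinarith [sq_nonneg (‖u n‖ - ‖v n‖), sq_nonneg ‖u n‖, sq_nonneg ‖v n‖]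

theorem summable_const_mul_mul_conj {u v : ℤ → ℂ} (hu : Summable fun n => ‖u n‖ ^ 2)
    (hv : Summable fun n => ‖v n‖ ^ 2) (c c' : ℂ) :
    Summable fun n => (c * u n) * conj (c' * v n) :=
  ((summable_mul_conj hu hv).mul_left (c * conj c')).congr fun n => by rw [map_mul]; ring

/-- The `(M + 1) × M` Vandermonde matrix `z_i^k`, `k ≤ M`: its columns span the signal
subspace. -/
noncomputable def signalMatrix {M : ℕ} (z : Fin M → ℂ) : Matrix (Fin (M + 1)) (Fin M) ℂ :=
  Matrix.of fun k i => z i ^ (k : ℕ)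

/-- The smoothed correlation matrix of the path signals `b_i`: the average over `m < M` of the
Gram matrices of the sequences `z_i^(m-M) b_i`. -/
noncomputable def smoothedGram {M : ℕ} (z : Fin M → ℂ) (b : Fin M → ℤ → ℂ) :
    Matrix (Fin M) (Fin M) ℂ :=
  Matrix.of fun i k => (1 / (M : ℂ)) * ∑ m : Fin M, ∑' n : ℤ,
    (z i ^ ((m : ℤ) - M) * b i n) * conj (z k ^ ((m : ℤ) - M) * b k n)

section ESPRIT

variable {M : ℕ} {z : Fin M → ℂ} {b : Fin M → ℤ → ℂ}

theorem signalMatrix_injective (hz : Function.Injective z) :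
    Function.Injective (signalMatrix z).mulVec :=
  injective_mulVec_of_pow (Nat.le_succ M) hz fun _ _ => rfl

/-- Shifting the subvector by `m` multiplies the `i`-th path by `z_i^m`; the Vandermonde factor
common to all subvectors comes out of the average. -/
theorem smoothedCorrelation_eq (hz0 : ∀ i, z i ≠ 0) (hb : ∀ i, Summable fun n => ‖b i n‖ ^ 2)
    {d : Fin (2 * M) → ℤ → ℂ} (hd : ∀ l n, d l n = ∑ i, z i ^ ((l : ℤ) - M) * b i n) :
    smoothedCorrelation M d =
      signalMatrix z * smoothedGram z b * (signalMatrix z).conjTranspose := by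
  ext k l
  have hs : ∀ (c c' : ℂ) i j, Summable fun n => (c * b i n) * conj (c' * b j n) :=
    fun c c' i j => summable_const_mul_mul_conj (hb i) (hb j) c c'
  have hpow : ∀ i (m : Fin M) (k : Fin (M + 1)),
      z i ^ (((m + k : ℕ) : ℤ) - M) = z i ^ (k : ℕ) * z i ^ ((m : ℤ) - M) := by
    intro i m k
    rw [← zpow_natCast, ← zpow_add₀ (hz0 i)]
    congr 1; push_cast; ring
  have hinner : ∀ m : Fin M, ∑' n : ℤ, d ⟨m + k, by omega⟩ n * conj (d ⟨m + l, by omega⟩ n)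
      = ∑ j, ∑ i, z i ^ (k : ℕ) * (∑' n : ℤ,
          (z i ^ ((m : ℤ) - M) * b i n) * conj (z j ^ ((m : ℤ) - M) * b j n)) *
          conj (z j ^ (l : ℕ)) := by
    intro m
    simp_rw [← tsum_mul_left, ← tsum_mul_right]
    have h0 : ∀ i j, Summable fun n => z i ^ (k : ℕ) *
        ((z i ^ ((m : ℤ) - M) * b i n) * conj (z j ^ ((m : ℤ) - M) * b j n)) *
          conj (z j ^ (l : ℕ)) := fun i j => ((hs _ _ i j).mul_left _).mul_right _
    simp_rw [← Summable.tsum_finsetSum (fun i _ => h0 i _)]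
    rw [← Summable.tsum_finsetSum (fun j _ => summable_sum fun i _ => h0 i j)]
    refine tsum_congr fun n => ?_
    simp only [hd, hpow, map_sum, Finset.sum_mul_sum]
    rw [Finset.sum_comm]
    refine Finset.sum_congr rfl fun j _ => Finset.sum_congr rfl fun i _ => ?_
    simp only [map_mul]; ring
  simp only [smoothedCorrelation, Matrix.of_apply, hinner, Matrix.mul_apply, signalMatrix,
    smoothedGram, Matrix.conjTranspose_apply, Finset.mul_sum, Finset.sum_mul, RCLike.star_def]
  rw [Finset.sum_comm]
  refine Finset.sum_congr rfl fun j _ => ?_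
  rw [Finset.sum_comm]
  refine Finset.sum_congr rfl fun i _ => Finset.sum_congr rfl fun m _ => ?_
  ring

open scoped ComplexOrder in
/-- Smoothing over `M` subvectors restores full rank, even when the path signals `b_i` are
proportional: a vector in the kernel of the Gram matrix would give a vanishing combination of
the `M` geometric sequences `m ↦ z_i^m`. -/
theorem smoothedGram_posDef (hz : Function.Injective z) (hz0 : ∀ i, z i ≠ 0)
    (hb : ∀ i, Summable fun n => ‖b i n‖ ^ 2) (hb0 : ∀ i, ∃ n, b i n ≠ 0) :
    (smoothedGram z b).PosDef := by
  have hs : ∀ (c c' : ℂ) i j, Summable fun n => (c * b i n) * conj (c' * b j n) :=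
    fun c c' i j => summable_const_mul_mul_conj (hb i) (hb j) c c'
  -- the quadratic form is a sum of squares
  have hterm : ∀ (x : Fin M → ℂ) (m : Fin M) (n : ℤ),
      ((‖∑ i, conj (x i) * (z i ^ ((m : ℤ) - M) * b i n)‖ ^ 2 : ℝ) : ℂ) =
        ∑ i, ∑ j, conj (x i) * ((z i ^ ((m : ℤ) - M) * b i n) *
          conj (z j ^ ((m : ℤ) - M) * b j n)) * x j := by
    intro x m n
    push_cast
    rw [← Complex.mul_conj', map_sum, Finset.sum_mul_sum]
    refine Finset.sum_congr rfl fun i _ => Finset.sum_congr rfl fun j _ => ?_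
    simp only [map_mul, Complex.conj_conj]; ring
  have h0 : ∀ (x : Fin M → ℂ) (m : Fin M) i j, Summable fun n => conj (x i) *
      ((z i ^ ((m : ℤ) - M) * b i n) * conj (z j ^ ((m : ℤ) - M) * b j n)) * x j :=
    fun x m i j => ((hs _ _ i j).mul_left _).mul_right _
  have hquad : ∀ x : Fin M → ℂ, dotProduct (star x) ((smoothedGram z b).mulVec x) =
      (((1 / (M : ℝ)) * ∑ m : Fin M, ∑' n : ℤ,
        ‖∑ i, conj (x i) * (z i ^ ((m : ℤ) - M) * b i n)‖ ^ 2 : ℝ) : ℂ) := by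
    intro x
    have hm : ∀ m : Fin M, ((∑' n : ℤ, ‖∑ i, conj (x i) * (z i ^ ((m : ℤ) - M) * b i n)‖ ^ 2 : ℝ)
        : ℂ) = ∑ i, ∑ j, conj (x i) * (∑' n : ℤ, (z i ^ ((m : ℤ) - M) * b i n) *
          conj (z j ^ ((m : ℤ) - M) * b j n)) * x j := by
      intro m
      simp_rw [← tsum_mul_left, ← tsum_mul_right, ← Summable.tsum_finsetSum (fun j _ => h0 x m _ j)]
      rw [← Summable.tsum_finsetSum (fun i _ => summable_sum fun j _ => h0 x m i j), ofReal_tsum]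
      exact tsum_congr fun n => hterm x m n
    rw [ofReal_mul, ofReal_sum]
    simp only [hm, dotProduct, Matrix.mulVec, smoothedGram, Matrix.of_apply, Finset.mul_sum,
      Finset.sum_mul, Pi.star_apply, RCLike.star_def]
    symm
    refine Finset.sum_comm.trans (Finset.sum_congr rfl fun i _ =>
      Finset.sum_comm.trans (Finset.sum_congr rfl fun j _ => Finset.sum_congr rfl fun m _ => ?_))
    push_cast
    ring
  refine Matrix.posDef_iff_dotProduct_mulVec.2 ⟨?_, fun x hx => ?_⟩
  · ext i k
    simp only [smoothedGram, Matrix.conjTranspose_apply, Matrix.of_apply, RCLike.star_def,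
      map_mul, map_sum, map_div₀, map_one, map_natCast, conj_tsum, Complex.conj_conj]
    refine congrArg _ (Finset.sum_congr rfl fun m _ => tsum_congr fun n => ?_)
    ring
  · rw [hquad, Complex.zero_lt_real]
    have hsum : ∀ m : Fin M, Summable fun n : ℤ =>
        ‖∑ i, conj (x i) * (z i ^ ((m : ℤ) - M) * b i n)‖ ^ 2 := by
      intro m
      rw [← Complex.summable_ofReal]
      simp_rw [hterm]
      exact summable_sum fun i _ => summable_sum fun j _ => h0 x m i j
    have hM : 0 < M := by
      rcases Nat.eq_zero_or_pos M with rfl | h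
      · exact absurd (Subsingleton.elim x 0) hx
      · exact h
    have hnn : ∀ m : Fin M, 0 ≤ ∑' n : ℤ,
        ‖∑ i, conj (x i) * (z i ^ ((m : ℤ) - M) * b i n)‖ ^ 2 :=
      fun m => tsum_nonneg fun n => by positivity
    refine mul_pos (by positivity) ((Finset.sum_nonneg fun m _ => hnn m).lt_of_ne' fun hzero => ?_)
    have hvan : ∀ (m : Fin M) n, ∑ i, conj (x i) * (z i ^ ((m : ℤ) - M) * b i n) = 0 := by
      intro m n
      have h1 := (Finset.sum_eq_zero_iff_of_nonneg fun m _ => hnn m).1 hzero m (Finset.mem_univ m)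
      have h2 := (hasSum_zero_iff_of_nonneg fun n => by positivity).1 (h1 ▸ (hsum m).hasSum)
      simpa using congrFun h2 n
    refine hx (funext fun i => ?_)
    obtain ⟨n, hn⟩ := hb0 i
    have h3 : (fun i => conj (x i) * (z i ^ (-(M : ℤ)) * b i n)) = 0 := by
      refine eq_zero_of_sum_mul_pow_eq_zero hz fun m hm => ?_
      rw [← hvan ⟨m, hm⟩ n]
      refine Finset.sum_congr rfl fun i _ => ?_
      rw [sub_eq_add_neg, zpow_add₀ (hz0 i), zpow_natCast]
      ring
    have h4 := congrFun h3 i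
    simpa [hn, zpow_ne_zero _ (hz0 i), hz0 i] using h4

theorem rank_smoothedCorrelation (hz : Function.Injective z)
    {R : Matrix (Fin (M + 1)) (Fin (M + 1)) ℂ} {G : Matrix (Fin M) (Fin M) ℂ} (hG : IsUnit G)
    (hR : R = signalMatrix z * G * (signalMatrix z).conjTranspose) : R.rank = M := by
  obtain ⟨Q, -, hQ⟩ := exists_isMoorePenrose (signalMatrix_injective hz)
  apply le_antisymm
  · rw [hR, Matrix.mul_assoc]
    exact (Matrix.rank_mul_le_left _ _).trans ((Matrix.rank_le_card_width _).trans (by simp))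
  · have hGR : G = Q * R * Q.conjTranspose := by
      have h1 : (signalMatrix z).conjTranspose * Q.conjTranspose = 1 := by
        rw [← Matrix.conjTranspose_mul, hQ, Matrix.conjTranspose_one]
      rw [hR]
      simp only [Matrix.mul_assoc, h1, Matrix.mul_one]
      rw [← Matrix.mul_assoc, hQ, Matrix.one_mul]
    have h2 : G.rank = M := by simpa using Matrix.rank_of_isUnit G hG
    calc M = G.rank := h2.symm
      _ = (Q * R * Q.conjTranspose).rank := by rw [← hGR]
      _ ≤ (Q * R).rank := Matrix.rank_mul_le_left _ _
      _ ≤ R.rank := Matrix.rank_mul_le_right _ _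

/-- The singular vectors span the column space of the Vandermonde matrix. -/
theorem IsSignalSubspace.exists_eq_mul {R : Matrix (Fin (M + 1)) (Fin (M + 1)) ℂ}
    {G : Matrix (Fin M) (Fin M) ℂ}
    (hR : R = signalMatrix z * G * (signalMatrix z).conjTranspose)
    {E : Matrix (Fin (M + 1)) (Fin M) ℂ} (hE : IsSignalSubspace R E) :
    ∃ Q Q' : Matrix (Fin M) (Fin M) ℂ, E = signalMatrix z * Q ∧ Q' * Q = 1 := by
  obtain ⟨U, V, σ, e, hU, hV, -, hsvd, he, rfl⟩ := hE
  have hσ : ∀ j, σ (e j) ≠ 0 := fun j => by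
    have : e j ∈ {a | σ a ≠ 0} := he ▸ Set.mem_range_self j
    exact this
  have hVV : V.conjTranspose * V = 1 := (Matrix.mem_unitaryGroup_iff'.1 hV)
  have hUU : U.conjTranspose * U = 1 := (Matrix.mem_unitaryGroup_iff'.1 hU)
  have hRV : R * V = U * Matrix.diagonal (fun a => (σ a : ℂ)) := by
    rw [hsvd, Matrix.mul_assoc, hVV, Matrix.mul_one]
  -- a left singular vector with nonzero singular value lies in the range of `R`
  set X : Matrix (Fin (M + 1)) (Fin M) ℂ := Matrix.of fun a j => V a (e j) / σ (e j) with hX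
  have hE : U.submatrix id e = R * X := by
    ext k j
    have h1 := congrFun (congrFun hRV k) (e j)
    rw [Matrix.mul_diagonal, Matrix.mul_apply] at h1
    simp only [Matrix.submatrix_apply, id, Matrix.mul_apply, hX, Matrix.of_apply]
    have h2 : (σ (e j) : ℂ) ≠ 0 := by exact_mod_cast hσ j
    simp_rw [← mul_div_assoc]
    rw [← Finset.sum_div, h1, mul_div_assoc, div_self h2, mul_one]
  have hortho : (U.submatrix id e).conjTranspose * U.submatrix id e = 1 := by
    ext i j
    have := congrFun (congrFun hUU (e i)) (e j)
    simpa [Matrix.mul_apply, Matrix.one_apply] using this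
  have hfac : U.submatrix id e =
      signalMatrix z * (G * (signalMatrix z).conjTranspose * X) := by
    rw [hE, hR]; simp only [Matrix.mul_assoc]
  refine ⟨_, (U.submatrix id e).conjTranspose * signalMatrix z, hfac, ?_⟩
  rw [Matrix.mul_assoc, ← hfac, hortho]

open scoped ComplexOrder in
/-- For a positive semidefinite matrix the spectral decomposition is a singular value
decomposition. -/
theorem exists_isSignalSubspace {k r : ℕ} {R : Matrix (Fin k) (Fin k) ℂ} (hR : R.PosSemidef)
    (hr : R.rank = r) : ∃ E : Matrix (Fin k) (Fin r) ℂ, IsSignalSubspace R E := by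
  have hH := hR.isHermitian
  have hcard : Fintype.card {a // hH.eigenvalues a ≠ 0} = r := by
    rw [← hH.rank_eq_card_non_zero_eigs, hr]
  obtain ⟨f⟩ : Nonempty (Fin r ≃ {a // hH.eigenvalues a ≠ 0}) :=
    Fintype.card_eq.1 (by simp [hcard])
  refine ⟨_, hH.eigenvectorUnitary, hH.eigenvectorUnitary, hH.eigenvalues,
    f.toEmbedding.trans (Function.Embedding.subtype _), hH.eigenvectorUnitary.2,
    hH.eigenvectorUnitary.2, hR.eigenvalues_nonneg, ?_, ?_, rfl⟩
  · have := hH.spectral_theorem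
    rw [Unitary.conjStarAlgAut_apply] at this
    exact this
  · ext a
    simp only [Set.mem_range, Function.Embedding.trans_apply, Equiv.coe_toEmbedding,
      Function.Embedding.subtype_apply, Set.mem_ofPred_eq]
    constructor
    · rintro ⟨j, rfl⟩; exact (f j).2
    · intro h; exact ⟨f.symm ⟨a, h⟩, by simp⟩

/-- Rotational invariance: `V↑ = V↓ diag(z)`, so `E↓⁻¹ E↑` is similar to `diag(z)`. -/
theorem exists_isMoorePenrose_rotation (hz : Function.Injective z)
    {E : Matrix (Fin (M + 1)) (Fin M) ℂ} {Q Q' : Matrix (Fin M) (Fin M) ℂ}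
    (hE : E = signalMatrix z * Q) (hQ : Q' * Q = 1) :
    (∃ P, IsMoorePenrose (E.submatrix Fin.castSucc id) P) ∧
      ∀ P, IsMoorePenrose (E.submatrix Fin.castSucc id) P →
        (P * E.submatrix Fin.succ id).charpoly.roots = Finset.univ.val.map z := by
  set V : Matrix (Fin M) (Fin M) ℂ := Matrix.of fun k i => z i ^ (k : ℕ) with hV
  have hdown : E.submatrix Fin.castSucc id = V * Q := by
    rw [hE]; ext k i; simp [Matrix.mul_apply, signalMatrix, hV]
  have hup : E.submatrix Fin.succ id = V * Matrix.diagonal z * Q := by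
    rw [hE]; ext k i
    rw [Matrix.submatrix_apply, Matrix.mul_apply, Matrix.mul_apply]
    refine Finset.sum_congr rfl fun j _ => ?_
    rw [Matrix.mul_diagonal]
    simp [signalMatrix, hV, pow_succ]
  obtain ⟨Y, -, hY⟩ := exists_isMoorePenrose (injective_mulVec_of_pow (A := V) le_rfl hz
    fun _ _ => rfl)
  have hleft : (Q' * Y) * (V * Q) = 1 := by
    rw [Matrix.mul_assoc, ← Matrix.mul_assoc Y, hY, Matrix.one_mul, hQ]
  have hright : (V * Q) * (Q' * Y) = 1 := mul_eq_one_comm.1 hleft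
  rw [hdown, hup]
  refine ⟨⟨Q' * Y, ?_, ?_, ?_, ?_⟩, fun P hP => ?_⟩
  · rw [hright, Matrix.one_mul]
  · rw [hleft, Matrix.one_mul]
  · rw [hright]; exact Matrix.isHermitian_one
  · rw [hleft]; exact Matrix.isHermitian_one
  · have h1 : P * (V * Q) = 1 := hP.mul_eq_one hleft
    have h2 : Q * (P * V) = 1 := by
      rw [mul_eq_one_comm, Matrix.mul_assoc, h1]
    rw [Matrix.mul_assoc V, ← Matrix.mul_assoc, Matrix.charpoly_mul_comm, Matrix.mul_assoc, h2,
      Matrix.mul_one, Matrix.charpoly_diagonal, roots_prod_X_sub_C_univ]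

end ESPRIT

/-- A delay in `[0, T)` is determined by the argument of `e^{-j2πτ/T}`, taken in any branch. -/
theorem delay_eq_iff {T : ℝ} (hT : 0 < T) {t t' : ℝ} (ht : t ∈ Set.Ico 0 T) :
    (t' ∈ Set.Ico 0 T ∧ ∃ k : ℤ, t' = -(T / (2 * Real.pi)) *
      (arg (exp (-I * ((2 * Real.pi / T * t : ℝ) : ℂ))) + 2 * Real.pi * k)) ↔ t' = t := by
  have hpi := Real.pi_pos
  have harg : arg (exp (-I * ((2 * Real.pi / T * t : ℝ) : ℂ))) =
      -(2 * Real.pi / T * t) -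
        toIocDiv Real.two_pi_pos (-Real.pi) (-(2 * Real.pi / T * t)) * (2 * Real.pi) := by
    rw [show -I * ((2 * Real.pi / T * t : ℝ) : ℂ) = ((-(2 * Real.pi / T * t) : ℝ) : ℂ) * I by
      push_cast; ring, Complex.arg_exp_mul_I, toIocMod, zsmul_eq_mul]
  rw [harg]
  set q := toIocDiv Real.two_pi_pos (-Real.pi) (-(2 * Real.pi / T * t))
  have hform : ∀ k : ℤ, -(T / (2 * Real.pi)) *
      (-(2 * Real.pi / T * t) - q * (2 * Real.pi) + 2 * Real.pi * k) = t + T * ((q - k : ℤ) : ℝ) := by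
    intro k
    push_cast
    field_simp
    ring
  constructor
  · rintro ⟨ht', k, hk⟩
    rw [hform] at hk
    have h1 : ((q - k : ℤ) : ℝ) < 1 := by
      by_contra h; push Not at h; nlinarith [ht.1, ht'.2]
    have h2 : -1 < ((q - k : ℤ) : ℝ) := by
      by_contra h; push Not at h; nlinarith [ht.2, ht'.1]
    have h3 : q - k = 0 := by
      have h1' : q - k < 1 := by exact_mod_cast h1
      have h2' : -1 < q - k := by exact_mod_cast h2
      omega
    rw [hk, h3]; simp
  · rintro rfl
    exact ⟨ht, q, by rw [hform]; simp⟩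

theorem exp_delay_injective {T : ℝ} (hT : 0 < T) {r : ℕ} {τ : Fin r → ℝ}
    (hτ : Function.Injective τ) (hmem : ∀ i, τ i ∈ Set.Ico 0 T) :
    Function.Injective fun i => exp (-I * ((2 * Real.pi / T * τ i : ℝ) : ℂ)) := by
  intro i j hij
  have h := (delay_eq_iff hT (hmem i)).2 rfl
  rw [show exp (-I * ((2 * Real.pi / T * τ i : ℝ) : ℂ)) = _ from hij] at h
  exact hτ ((delay_eq_iff hT (hmem j)).1 h)

open scoped ComplexOrder in
/-- On measurements of the form `d_l[n] = ∑ z_i^{l-M} b_i[n]`, ESPRIT with smoothing returns the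
true delays, in an arbitrary order. -/
theorem isDelayEstimate_iff {T : ℝ} (hT : 0 < T) {M : ℕ} {τ : Fin M → ℝ}
    (hτ : Function.Injective τ) (hmem : ∀ i, τ i ∈ Set.Ico 0 T) {b : Fin M → ℤ → ℂ}
    (hb : ∀ i, Summable fun n => ‖b i n‖ ^ 2) (hb0 : ∀ i, ∃ n, b i n ≠ 0)
    {d : Fin (2 * M) → ℤ → ℂ}
    (hd : ∀ l n, d l n =
      ∑ i, exp (-I * ((2 * Real.pi / T * τ i : ℝ) : ℂ)) ^ ((l : ℤ) - M) * b i n)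
    {r : ℕ} (τ' : Fin r → ℝ) :
    IsDelayEstimate T M d r τ' ↔ ∃ e : Fin r ≃ Fin M, τ' = τ ∘ e := by
  set z : Fin M → ℂ := fun i => exp (-I * ((2 * Real.pi / T * τ i : ℝ) : ℂ)) with hzdef
  have hz : Function.Injective z := exp_delay_injective hT hτ hmem
  have hz0 : ∀ i, z i ≠ 0 := fun i => exp_ne_zero _
  have hG := smoothedGram_posDef hz hz0 hb hb0
  have hR := smoothedCorrelation_eq hz0 hb hd
  have hrank : (smoothedCorrelation M d).rank = M :=
    rank_smoothedCorrelation hz hG.isUnit hR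
  constructor
  · rintro ⟨hr, E, P, ev, hE, hP, hroots, hτ'⟩
    obtain rfl : r = M := hr.trans hrank
    obtain ⟨Q, Q', hEQ, hQ⟩ := hE.exists_eq_mul hR
    rw [(exists_isMoorePenrose_rotation hz hEQ hQ).2 P hP] at hroots
    obtain ⟨e, rfl⟩ := exists_equiv_of_map_univ_eq hz hroots.symm
    exact ⟨e, funext fun i => (delay_eq_iff hT (hmem (e i))).1 (hτ' i)⟩
  · rintro ⟨e, rfl⟩
    obtain rfl : r = M := by simpa using Fintype.card_congr e
    have hpsd : (smoothedCorrelation r d).PosSemidef := by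
      rw [hR]; exact hG.posSemidef.mul_mul_conjTranspose_same _
    obtain ⟨E, hE⟩ := exists_isSignalSubspace hpsd hrank
    obtain ⟨Q, Q', hEQ, hQ⟩ := hE.exists_eq_mul hR
    obtain ⟨⟨P, hP⟩, hroots⟩ := exists_isMoorePenrose_rotation hz hEQ hQ
    exact ⟨hrank.symm, E, P, z ∘ e, hE, hP, by rw [hroots P hP, map_univ_comp_equiv],
      fun i => (delay_eq_iff hT (hmem (e i))).2 rfl⟩

/-! ### The discrete-time Fourier transform -/

section DTFT

variable {T : ℝ}

/-- The kernel `e^{jωnT}` of the inverse transform is conjugate to that of `fourierCoeffOn`, whence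
the change of sign of the index. -/
theorem idtft_eq_fourierCoeffOn (hT : 0 < T) (hP : 0 < 2 * Real.pi / T) (A : ℝ → ℂ) (n : ℤ) :
    idtft T A n = fourierCoeffOn hP A (-n) := by
  have hpi := Real.pi_pos
  have hT' : (T : ℂ) ≠ 0 := by exact_mod_cast hT.ne'
  have hpi' : (Real.pi : ℂ) ≠ 0 := by exact_mod_cast hpi.ne'
  rw [fourierCoeffOn_eq_integral, intervalIntegral.integral_of_le hP.le, integral_Ioc_eq_integral_Ioo,
    Complex.real_smul, idtft]
  congr 1
  · push_cast; rw [sub_zero, one_div_div]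
  · refine setIntegral_congr_fun measurableSet_Ioo fun ω _ => ?_
    simp only [smul_eq_mul]
    rw [mul_comm, fourier_coe_apply]
    congr 2
    push_cast
    field_simp
    ring

theorem idtft_congr_ae {A B : ℝ → ℂ}
    (h : A =ᵐ[volume.restrict (Set.Ioo 0 (2 * Real.pi / T))] B) (n : ℤ) :
    idtft T A n = idtft T B n := by
  unfold idtft
  congr 1
  refine integral_congr_ae ?_
  filter_upwards [h] with ω hω
  rw [hω]

theorem restrict_Ioo_eq_restrict_Ioc (a b : ℝ) :
    (volume : Measure ℝ).restrict (Set.Ioo a b) = volume.restrict (Set.Ioc a b) :=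
  Measure.restrict_congr_set Ioo_ae_eq_Ioc

theorem summable_sq_idtft (hT : 0 < T) {A : ℝ → ℂ}
    (hA : MemLp A 2 (volume.restrict (Set.Ioo 0 (2 * Real.pi / T)))) :
    Summable fun n => ‖idtft T A n‖ ^ 2 := by
  have hP : 0 < 2 * Real.pi / T := by positivity
  rw [restrict_Ioo_eq_restrict_Ioc] at hA
  have h := (hasSum_sq_fourierCoeffOn hP hA).summable
  simp_rw [idtft_eq_fourierCoeffOn hT hP]
  exact (Equiv.neg ℤ).summable_iff.2 h

theorem idtft_fun_sum {ι : Type*} (s : Finset ι) {A : ι → ℝ → ℂ}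
    (hA : ∀ i ∈ s, IntegrableOn (A i) (Set.Ioo 0 (2 * Real.pi / T))) (c : ι → ℂ) (n : ℤ) :
    idtft T (fun ω => ∑ i ∈ s, c i * A i ω) n = ∑ i ∈ s, c i * idtft T (A i) n := by
  have hint : ∀ i ∈ s, IntegrableOn (fun ω => A i ω * exp (I * ((ω * n * T : ℝ) : ℂ)))
      (Set.Ioo 0 (2 * Real.pi / T)) := by
    intro i hi
    refine (hA i hi).mul_bdd (c := 1) (by fun_prop) (ae_of_all _ fun ω => ?_)
    rw [mul_comm, Complex.norm_exp_ofReal_mul_I]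
  unfold idtft
  have hdist : ∀ ω : ℝ, (∑ i ∈ s, c i * A i ω) * exp (I * ((ω * n * T : ℝ) : ℂ)) =
      ∑ i ∈ s, c i * (A i ω * exp (I * ((ω * n * T : ℝ) : ℂ))) := fun ω => by
    simp only [Finset.sum_mul, mul_assoc]
  simp_rw [hdist]
  rw [integral_finsetSum _ fun i hi => (hint i hi).const_mul (c i), Finset.mul_sum]
  refine Finset.sum_congr rfl fun i _ => ?_
  rw [integral_const_mul]
  ring

/-- A square-integrable spectrum is determined by its inverse transform: by Parseval, the energy
of the difference of two spectra with the same coefficients vanishes. -/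
theorem ae_eq_of_idtft_eq (hT : 0 < T) {A B : ℝ → ℂ}
    (hA : MemLp A 2 (volume.restrict (Set.Ioo 0 (2 * Real.pi / T))))
    (hB : MemLp B 2 (volume.restrict (Set.Ioo 0 (2 * Real.pi / T))))
    (h : ∀ n, idtft T A n = idtft T B n) :
    A =ᵐ[volume.restrict (Set.Ioo 0 (2 * Real.pi / T))] B := by
  have hP : 0 < 2 * Real.pi / T := by positivity
  have hAB := hA.sub hB
  have hint : ∀ {A : ℝ → ℂ}, MemLp A 2 (volume.restrict (Set.Ioo 0 (2 * Real.pi / T))) →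
      IntegrableOn A (Set.Ioo 0 (2 * Real.pi / T)) := fun hA => hA.integrable (by norm_num)
  have hzero : ∀ n, fourierCoeffOn hP (A - B) n = 0 := by
    intro n
    have h1 := idtft_fun_sum (T := T) (Finset.univ : Finset Bool) (A := fun i => cond i A B)
      (fun i _ => by cases i; exacts [hint hB, hint hA]) (fun i => cond i 1 (-1)) (-n)
    have h2 := idtft_eq_fourierCoeffOn hT hP (A - B) (-n)
    rw [neg_neg] at h2
    rw [← h2]
    simp only [Fintype.sum_bool, cond_true, cond_false, h (-n)] at h1
    rw [show A - B = fun ω => 1 * A ω + -1 * B ω by funext ω; simp [sub_eq_add_neg], h1]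
    ring
  rw [restrict_Ioo_eq_restrict_Ioc] at hAB ⊢
  have hpars := tsum_sq_fourierCoeffOn hP hAB
  simp only [hzero, norm_zero, ne_eq, OfNat.ofNat_ne_zero, not_false_eq_true, zero_pow, tsum_zero,
    sub_zero, smul_eq_mul] at hpars
  have h0 : ∫ ω in Set.Ioc 0 (2 * Real.pi / T), ‖(A - B) ω‖ ^ 2 = 0 := by
    rw [intervalIntegral.integral_of_le hP.le] at hpars
    exact (mul_eq_zero.1 hpars.symm).resolve_left (by positivity)
  have h1 := (integral_eq_zero_iff_of_nonneg (fun ω => by positivity)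
    (by simpa using hAB.integrable_norm_pow (by norm_num))).1 h0
  filter_upwards [h1] with ω hω
  simpa [sub_eq_zero] using hω

theorem idtft_exp (hT : 0 < T) (m n : ℤ) :
    idtft T (fun ω => exp (-I * ((ω * m * T : ℝ) : ℂ))) n = if m = n then 1 else 0 := by
  have hP : 0 < 2 * Real.pi / T := by positivity
  have hT' : (T : ℂ) ≠ 0 := by exact_mod_cast hT.ne'
  have hpi' : (Real.pi : ℂ) ≠ 0 := by exact_mod_cast Real.pi_ne_zero
  have hfun : ∀ ω : ℝ, exp (-I * ((ω * m * T : ℝ) : ℂ)) * exp (I * ((ω * n * T : ℝ) : ℂ)) =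
      exp ((I * (n - m) * T) * ω) := by
    intro ω
    rw [← Complex.exp_add]; congr 1; push_cast; ring
  unfold idtft
  simp_rw [hfun]
  rw [← integral_Ioc_eq_integral_Ioo, ← intervalIntegral.integral_of_le hP.le]
  split_ifs with h
  · subst h
    simp
    field_simp
  · have hc : (I * (n - m) * T : ℂ) ≠ 0 := by
      refine mul_ne_zero (mul_ne_zero I_ne_zero (sub_ne_zero.2 ?_)) hT'
      exact_mod_cast Ne.symm h
    rw [integral_exp_mul_complex hc]
    have : (I * (n - m) * T : ℂ) * ((2 * Real.pi / T : ℝ) : ℂ) =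
        ((n - m : ℤ) : ℂ) * (2 * Real.pi * I) := by
      push_cast; field_simp
    rw [this, Complex.exp_int_mul_two_pi_mul_I]
    simp

/-- The inverse transform of a trigonometric polynomial returns its coefficients. -/
theorem idtft_trigPoly (hT : 0 < T) {N : ℕ} (a : Fin N → ℂ) (n : Fin N) :
    idtft T (fun ω => ∑ k : Fin N, a k * exp (-I * ((ω * (k : ℕ) * T : ℝ) : ℂ))) (n : ℕ) = a n := by
  have hexp := idtft_fun_sum (T := T) (Finset.univ : Finset (Fin N))
    (A := fun k ω => exp (-I * ((ω * ((k : ℕ) : ℤ) * T : ℝ) : ℂ)))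
    (fun k _ => (Continuous.integrableOn_Icc (by fun_prop)).mono_set Set.Ioo_subset_Icc_self) a
    ((n : ℕ) : ℤ)
  simp only [idtft_exp hT] at hexp
  simp only [Int.cast_natCast] at hexp
  rw [hexp]
  simp [Fin.val_inj]

end DTFT

/-! ### Translations and the Plancherel formula -/

theorem measurePreserving_sub_const (b : ℝ) :
    MeasurePreserving (fun u : ℝ => u - b) volume volume :=
  measurePreserving_sub_right volume b

theorem norm_exp_I_mul (r : ℝ) : ‖exp (I * (r : ℂ))‖ = 1 := by
  rw [mul_comm, Complex.norm_exp_ofReal_mul_I]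

theorem memLp_exp_mul (b : ℝ) (f : Signal) :
    MemLp (fun ξ : ℝ => exp (I * ((2 * Real.pi * b * ξ : ℝ) : ℂ)) * f ξ) 2 volume := by
  refine (Lp.memLp f).of_le_mul (c := 1) ?_ (ae_of_all _ fun ξ => ?_)
  · exact (Continuous.aestronglyMeasurable (by fun_prop)).mul (Lp.aestronglyMeasurable f)
  · rw [norm_mul, norm_exp_I_mul]

theorem fourier_compSubConst (b : ℝ) (φ : SchwartzMap ℝ ℂ) (ξ : ℝ) :
    (𝓕 (SchwartzMap.compSubConstCLM ℂ b φ)) ξ =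
      exp (-I * ((2 * Real.pi * b * ξ : ℝ) : ℂ)) * (𝓕 φ) ξ := by
  have h := congrFun (VectorFourier.fourierIntegral_comp_add_right Real.fourierChar volume
    (innerₗ ℝ) (φ : ℝ → ℂ) (-b)) ξ
  rw [SchwartzMap.fourier_coe, SchwartzMap.fourier_coe]
  refine h.trans ?_
  rw [Circle.smul_def, smul_eq_mul, Real.fourierChar_apply]
  congr 2
  simp only [innerₗ_apply_apply, RCLike.inner_apply, conj_trivial]
  push_cast
  ring

/-- Plancherel's formula for a translate: translation by `b` modulates the Fourier transform by
`e^{-2πjbξ}`. The formula is checked on Schwartz functions and extended by density. -/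
theorem integral_translate_mul_conj (f h : Signal) (b : ℝ) :
    ∫ u, f (u - b) * conj (h u) =
      ∫ ξ, exp (-I * ((2 * Real.pi * b * ξ : ℝ) : ℂ)) * ((𝓕 f : Signal) ξ) *
        conj ((𝓕 h : Signal) ξ) := by
  -- moving the phase onto the fixed signal `h` makes both sides continuous in `f`
  set K : Signal := (memLp_exp_mul b (𝓕 h : Signal)).toLp with hK
  have hmp := measurePreserving_sub_const b
  have key : (fun f : Signal => inner ℂ h (Lp.compMeasurePreserving _ hmp f)) =
      fun f : Signal => inner ℂ K (𝓕 f : Signal) := by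
    refine DenseRange.equalizer (SchwartzMap.denseRange_toLpCLM (F := ℂ) (E := ℝ) (μ := volume)
      (p := 2) ENNReal.ofNat_ne_top) ?_ ?_ ?_
    · exact continuous_const.inner (Lp.isometry_compMeasurePreserving hmp).continuous
    · exact continuous_const.inner FourierTransform.continuous_fourier
    · funext φ
      have h1 : Lp.compMeasurePreserving _ hmp (φ.toLp 2) =
          (SchwartzMap.compSubConstCLM ℂ b φ).toLp 2 := rfl
      simp only [Function.comp_apply, SchwartzMap.toLpCLM_apply]
      rw [h1, ← Lp.inner_fourier_eq, SchwartzMap.toLp_fourier_eq, SchwartzMap.toLp_fourier_eq,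
        L2.inner_def, L2.inner_def]
      refine integral_congr_ae ?_
      filter_upwards [(memLp_exp_mul b (𝓕 h : Signal)).coeFn_toLp,
        SchwartzMap.coeFn_toLp (𝓕 (SchwartzMap.compSubConstCLM ℂ b φ)) 2,
        SchwartzMap.coeFn_toLp (𝓕 φ) 2] with ξ h1 h2 h3
      rw [h1, h2, h3, fourier_compSubConst]
      simp only [RCLike.inner_apply, map_mul, ← Complex.exp_conj, Complex.conj_I,
        Complex.conj_ofReal]
      ring
  have := congrFun key f
  simp only [L2.inner_def] at this
  refine Eq.trans ?_ (this.trans ?_)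
  · refine integral_congr_ae ?_
    filter_upwards [Lp.coeFn_compMeasurePreserving f hmp] with u hu
    rw [hu]; simp [RCLike.inner_apply]
  · refine integral_congr_ae ?_
    filter_upwards [(memLp_exp_mul b (𝓕 h : Signal)).coeFn_toLp] with ξ h1
    rw [h1]
    simp only [RCLike.inner_apply, map_mul, ← Complex.exp_conj, Complex.conj_I,
      Complex.conj_ofReal]
    ring

theorem angularFT_stronglyMeasurable (f : Signal) : StronglyMeasurable (angularFT f) :=
  (Lp.stronglyMeasurable (𝓕 f : Signal)).comp_measurable (by fun_prop)

theorem integrable_exp_mul_angularFT (f h : Signal) (b : ℝ) :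
    Integrable fun ω : ℝ => exp (I * ((ω * b : ℝ) : ℂ)) * (angularFT f ω * conj (angularFT h ω)) := by
  have h1 : Integrable fun ξ => (𝓕 f : Signal) ξ * conj ((𝓕 h : Signal) ξ) :=
    (Lp.memLp (𝓕 f : Signal)).integrable_mul (Lp.memLp (𝓕 h : Signal)).star
  have h2 := h1.comp_div (R := 2 * Real.pi) (by positivity)
  refine Integrable.bdd_mul (c := 1) h2 (by fun_prop) (ae_of_all _ fun ω => ?_)
  rw [norm_exp_I_mul]

/-- The correlation of two translates, in angular frequency. -/
theorem integral_translate_mul_conj_translate (f h : Signal) (a t : ℝ) :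
    ∫ u, f (u - a) * conj (h (u - t)) = ((1 / (2 * Real.pi) : ℝ) : ℂ) *
      ∫ ω : ℝ, exp (I * ((ω * (t - a) : ℝ) : ℂ)) * (angularFT f ω * conj (angularFT h ω)) := by
  have h1 := integral_sub_right_eq_self (μ := volume)
    (fun u => f (u - (a - t)) * conj (h u)) t
  simp only [show ∀ u : ℝ, u - t - (a - t) = u - a by intro u; ring] at h1
  rw [h1, integral_translate_mul_conj]
  have h2 := Measure.integral_comp_div (fun ξ : ℝ => exp (-I * ((2 * Real.pi * (a - t) * ξ : ℝ) : ℂ)) *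
    ((𝓕 f : Signal) ξ) * conj ((𝓕 h : Signal) ξ)) (2 * Real.pi)
  have hpi : |2 * Real.pi| = 2 * Real.pi := abs_of_pos (by positivity)
  rw [hpi] at h2
  rw [show (∫ ω : ℝ, exp (I * ((ω * (t - a) : ℝ) : ℂ)) * (angularFT f ω * conj (angularFT h ω))) =
    ∫ ω : ℝ, exp (-I * ((2 * Real.pi * (a - t) * (ω / (2 * Real.pi)) : ℝ) : ℂ)) *
    ((𝓕 f : Signal) (ω / (2 * Real.pi))) * conj ((𝓕 h : Signal) (ω / (2 * Real.pi))) from ?_, h2,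
    Complex.real_smul, ← mul_assoc, ← Complex.ofReal_mul, one_div, inv_mul_cancel₀ (by positivity)]
  · simp
  · congr 1
    funext ω
    rw [mul_assoc]
    congr 2
    push_cast
    have : (Real.pi : ℂ) ≠ 0 := by exact_mod_cast Real.pi_ne_zero
    field_simp
    ring

/-- An integral over a band of `2M` periods of length `P`, folded onto one period. -/
theorem integral_fold {P : ℝ} (hP : 0 < P) (M : ℕ) {F : ℝ → ℂ} (hF : Integrable F)
    (hF0 : ∀ᵐ ω, ω ∉ Set.Icc (-(M * P)) (M * P) → F ω = 0) :
    ∫ ω, F ω = ∫ ω in Set.Ioo 0 P, ∑ m : Fin (2 * M), F (ω + P * ((m : ℕ) - M)) := by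
  have h1 : ∫ ω, F ω = ∫ ω in -(M * P)..(M * P), F ω := by
    rw [intervalIntegral.integral_of_le (by have : 0 ≤ M * P := by positivity
                                            linarith), ← integral_Icc_eq_integral_Ioc]
    exact (setIntegral_eq_integral_of_ae_compl_eq_zero hF0).symm
  have h2 := intervalIntegral.sum_integral_adjacent_intervals (f := F) (μ := volume)
    (a := fun k : ℕ => P * ((k : ℝ) - M)) (n := 2 * M) (fun k _ => hF.intervalIntegrable)
  rw [h1, integral_finsetSum _ fun m _ => (hF.comp_add_right _).integrableOn]
  have e1 : P * (((0 : ℕ) : ℝ) - M) = -(M * P) := by push_cast; ring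
  have e2 : P * (((2 * M : ℕ) : ℝ) - M) = M * P := by push_cast; ring
  rw [e1, e2] at h2
  rw [← h2, ← Fin.sum_univ_eq_sum_range
    (fun k => ∫ ω in P * ((k : ℝ) - M)..P * (((k + 1 : ℕ) : ℝ) - M), F ω)]
  refine Finset.sum_congr rfl fun m _ => ?_
  rw [← integral_Ioc_eq_integral_Ioo, ← intervalIntegral.integral_of_le hP.le,
    intervalIntegral.integral_comp_add_right]
  congr 1
  · ring
  · push_cast; ring

/-! ### The sampling stage -/

/-- The node `e^{-j2πτ/T}` of a delay `τ`. -/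
noncomputable def delayNode (T τ : ℝ) : ℂ := exp (-I * ((2 * Real.pi / T * τ : ℝ) : ℂ))

theorem delayNode_zpow (T τ : ℝ) (k : ℤ) :
    delayNode T τ ^ k = exp (-I * ((2 * Real.pi / T * k * τ : ℝ) : ℂ)) := by
  rw [delayNode, ← Complex.exp_int_mul]
  congr 1; push_cast; ring

namespace ParametricSystem

variable (H : ParametricSystem)

/-- The discrete-time Fourier transform `A_i(ω) = ∑_n a_i[n] e^{-jωnT}` of the sequence of
pulse coefficients of the `i`-th path. -/
noncomputable def pulseSpectrum (T : ℝ) {N : ℕ} (x : Fin N → ℂ) (i : Fin H.Kτ) (ω : ℝ) : ℂ :=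
  ∑ n : Fin N, H.pulseCoeff T x i n * exp (-I * ((ω * (n : ℕ) * T : ℝ) : ℂ))

/-- The spectrum `e^{-jωτ_i} A_i(ω)` of the delayed `i`-th path. -/
noncomputable def pathSpectrum (T : ℝ) {N : ℕ} (x : Fin N → ℂ) (i : Fin H.Kτ) (ω : ℝ) : ℂ :=
  exp (-I * ((ω * H.τ i : ℝ) : ℂ)) * H.pulseSpectrum T x i ω

/-- The noiseless modified measurements `d_m(ω) = ∑_i e^{-j(2π/T)m'τ_i} e^{-jωτ_i} A_i(ω)`,
`m' = m - p/2`. -/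
noncomputable def modifiedSpectrum (T : ℝ) {N : ℕ} (x : Fin N → ℂ) (ω : ℝ)
    (m : Fin (2 * H.Kτ)) : ℂ :=
  ∑ i, delayNode T (H.τ i) ^ ((m : ℤ) - H.Kτ) * H.pathSpectrum T x i ω

variable {H} {T : ℝ} {N : ℕ} {x : Fin N → ℂ}

theorem continuous_pulseSpectrum (i : Fin H.Kτ) : Continuous (H.pulseSpectrum T x i) := by
  unfold pulseSpectrum; fun_prop

theorem continuous_pathSpectrum (i : Fin H.Kτ) : Continuous (H.pathSpectrum T x i) := by
  have := continuous_pulseSpectrum (T := T) (x := x) i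
  unfold pathSpectrum; fun_prop

theorem continuous_modifiedSpectrum (m : Fin (2 * H.Kτ)) :
    Continuous fun ω => H.modifiedSpectrum T x ω m := by
  have := fun i => continuous_pathSpectrum (T := T) (x := x) (H := H) i
  unfold modifiedSpectrum; fun_prop

end ParametricSystem

theorem Continuous.memLp_Ioo {f : ℝ → ℂ} (hf : Continuous f) (a b : ℝ) :
    MemLp f 2 (volume.restrict (Set.Ioo a b)) := by
  obtain ⟨C, hC⟩ := isCompact_Icc.exists_bound_of_continuousOn (s := Set.Icc a b) hf.continuousOn
  refine MemLp.of_bound hf.aestronglyMeasurable C ?_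
  filter_upwards [ae_restrict_mem measurableSet_Ioo] with ω hω
  exact hC ω (Set.Ioo_subset_Icc_self hω)

theorem workingBand_eq {T : ℝ} (M : ℕ) :
    workingBand T M = Set.Icc (-(M * (2 * Real.pi / T))) (M * (2 * Real.pi / T)) := by
  unfold workingBand
  rw [show Real.pi / T * ((2 * M : ℕ) : ℝ) = M * (2 * Real.pi / T) by push_cast; ring]

/-- The `2M` shifts of the period `(0, 2π/T)` stay inside the working band. -/
theorem shift_mem_workingBand {T : ℝ} (hT : 0 < T) {M : ℕ} (m : Fin (2 * M)) {ω : ℝ}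
    (hω : ω ∈ Set.Ioo 0 (2 * Real.pi / T)) :
    ω + 2 * Real.pi / T * ((m : ℕ) - M) ∈ workingBand T M := by
  rw [workingBand_eq]
  have hP : 0 < 2 * Real.pi / T := by positivity
  have h1 : ((m : ℕ) : ℝ) + 1 ≤ 2 * M := by exact_mod_cast m.2
  have h2 : (0 : ℝ) ≤ ((m : ℕ) : ℝ) := by positivity
  constructor
  · nlinarith [hω.1]
  · nlinarith [hω.2]

/-- Spectral bounds on the working band hold for the aliases of almost every frequency of the
period. -/
theorem BoundedOnBand.ae_shift {f : Signal} {T : ℝ} (hT : 0 < T) {M : ℕ}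
    (hf : BoundedOnBand f T M) :
    ∃ a b : ℝ, 0 < a ∧ ∀ᵐ ω ∂(volume.restrict (Set.Ioo 0 (2 * Real.pi / T))),
      ∀ m : Fin (2 * M), a ≤ ‖angularFT f (ω + 2 * Real.pi / T * ((m : ℕ) - M))‖ ∧
        ‖angularFT f (ω + 2 * Real.pi / T * ((m : ℕ) - M))‖ ≤ b := by
  obtain ⟨a, b, ha, h⟩ := hf
  refine ⟨a, b, ha, ?_⟩
  have h1 : ∀ m : Fin (2 * M), ∀ᵐ ω : ℝ, ω + 2 * Real.pi / T * ((m : ℕ) - M) ∈ workingBand T M →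
      a ≤ ‖angularFT f (ω + 2 * Real.pi / T * ((m : ℕ) - M))‖ ∧
        ‖angularFT f (ω + 2 * Real.pi / T * ((m : ℕ) - M))‖ ≤ b := fun m =>
    (measurePreserving_add_right volume (2 * Real.pi / T * ((m : ℕ) - M))).quasiMeasurePreserving.ae h
  filter_upwards [ae_restrict_mem measurableSet_Ioo, ae_restrict_of_ae (ae_all_iff.2 h1)]
    with ω hω h2 m
  exact h2 m (shift_mem_workingBand hT m hω)

/-- The correction matrix is a product of a diagonal matrix of phases, a discrete Fourier matrix
and the diagonal matrix of the aliases of `S* G / T`, hence invertible almost everywhere. -/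
theorem isUnit_det_correctionMatrix {g s : Signal} {T : ℝ} (hT : 0 < T) {M : ℕ} {ω : ℝ}
    (hg : ∀ m : Fin (2 * M), angularFT g (ω + 2 * Real.pi / T * ((m : ℕ) - M)) ≠ 0)
    (hs : ∀ m : Fin (2 * M), angularFT s (ω + 2 * Real.pi / T * ((m : ℕ) - M)) ≠ 0) :
    IsUnit (correctionMatrix g s T M ω).det := by
  rw [← Matrix.isUnit_iff_isUnit_det, ← Matrix.mulVec_injective_iff_isUnit]
  rw [← Matrix.coe_mulVecLin, ← LinearMap.ker_eq_bot, LinearMap.ker_eq_bot']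
  intro v hv
  set ζ : Fin (2 * M) → ℂ :=
    fun m => exp (I * ((2 * Real.pi / (2 * M : ℕ) * ((m : ℕ) - M) : ℝ) : ℂ)) with hζ
  have hζinj : Function.Injective ζ := by
    intro m m' h
    have hM : 0 < M := by have := m.2; omega
    have h1 := exp_delay_injective (T := ((2 * M : ℕ) : ℝ)) (by positivity)
      (τ := fun m : Fin (2 * M) => ((m : ℕ) : ℝ))
      (fun m m' h => Fin.ext (Nat.cast_injective h))
      (fun m => ⟨by positivity, by exact_mod_cast m.2⟩)
    have h2 : ∀ m : Fin (2 * M), exp (-I * ((2 * Real.pi / ((2 * M : ℕ) : ℝ) * ((m : ℕ) : ℝ) : ℝ) : ℂ))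
        = exp (-I * ((2 * Real.pi / (2 * M : ℕ) * M : ℝ) : ℂ)) * (ζ m)⁻¹ := by
      intro m
      rw [hζ, ← Complex.exp_neg, ← Complex.exp_add]
      congr 1; push_cast; ring
    refine h1 ?_
    simp only [h2, h]
  have hc : (fun m : Fin (2 * M) => ((1 / T : ℝ) : ℂ) * conj (angularFT s (ω + 2 * Real.pi / T * ((m : ℕ) - M))) *
      angularFT g (ω + 2 * Real.pi / T * ((m : ℕ) - M)) * v m) = 0 := by
    refine eq_zero_of_sum_mul_pow_eq_zero hζinj fun l hl => ?_
    have h3 := congrFun hv ⟨l, hl⟩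
    have h4 : (correctionMatrix g s T M ω).mulVec v ⟨l, hl⟩ =
        exp (I * ((ω * l * T / (2 * M : ℕ) : ℝ) : ℂ)) * ∑ m : Fin (2 * M),
          (((1 / T : ℝ) : ℂ) * conj (angularFT s (ω + 2 * Real.pi / T * ((m : ℕ) - M))) *
            angularFT g (ω + 2 * Real.pi / T * ((m : ℕ) - M)) * v m) * ζ m ^ l := by
      rw [Matrix.mulVec, dotProduct, Finset.mul_sum]
      refine Finset.sum_congr rfl fun m _ => ?_
      have h5 : ζ m ^ l =
          exp (I * ((2 * Real.pi / (2 * M : ℕ) * l * ((m : ℕ) - M) : ℝ) : ℂ)) := by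
        rw [hζ, ← Complex.exp_nat_mul]; congr 1; push_cast; ring
      rw [h5]
      simp only [correctionMatrix, Matrix.of_apply]
      ring
    rw [Matrix.mulVecLin_apply, h4] at h3
    exact (mul_eq_zero.1 h3).resolve_left (exp_ne_zero _)
  funext m
  have h6 := congrFun hc m
  have hT' : (T : ℂ) ≠ 0 := by exact_mod_cast hT.ne'
  simpa [hg m, hs m, hT'] using h6

theorem ae_isUnit_det_correctionMatrix {g s : Signal} {T : ℝ} (hT : 0 < T) {M : ℕ}
    (hg : BoundedOnBand g T M) (hs : BoundedOnBand s T M) :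
    ∀ᵐ ω ∂(volume.restrict (Set.Ioo 0 (2 * Real.pi / T))),
      IsUnit (correctionMatrix g s T M ω).det := by
  obtain ⟨a, b, ha, h1⟩ := hg.ae_shift hT
  obtain ⟨a', b', ha', h2⟩ := hs.ae_shift hT
  filter_upwards [h1, h2] with ω h1 h2
  exact isUnit_det_correctionMatrix hT (fun m => norm_pos_iff.1 (ha.trans_le (h1 m).1))
    (fun m => norm_pos_iff.1 (ha'.trans_le (h2 m).1))

theorem memLp_correctionMatrix_mulVec {g s : Signal} {T : ℝ} (hT : 0 < T) {M : ℕ}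
    (hg : BoundedOnBand g T M) (hs : BoundedOnBand s T M) {d : ℝ → Fin (2 * M) → ℂ}
    (hd : ∀ m, Continuous fun ω => d ω m) (l : Fin (2 * M)) :
    MemLp (fun ω => (correctionMatrix g s T M ω).mulVec (d ω) l) 2
      (volume.restrict (Set.Ioo 0 (2 * Real.pi / T))) := by
  obtain ⟨a, b, ha, h1⟩ := hg.ae_shift hT
  obtain ⟨a', b', ha', h2⟩ := hs.ae_shift hT
  have hG := angularFT_stronglyMeasurable g
  have hS := angularFT_stronglyMeasurable s
  simp only [Matrix.mulVec, dotProduct]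
  refine memLp_finsetSum _ fun m _ => ?_
  refine ((hd m).memLp_Ioo 0 (2 * Real.pi / T)).of_le_mul (c := 1 / T * b' * b) ?_ ?_
  · refine (StronglyMeasurable.mul ?_ (hd m).stronglyMeasurable).aestronglyMeasurable
    have hs' : StronglyMeasurable fun ω : ℝ =>
        conj (angularFT s (ω + 2 * Real.pi / T * ((m : ℕ) - M))) :=
      Complex.continuous_conj.comp_stronglyMeasurable (hS.comp_measurable (by fun_prop))
    have hg' : StronglyMeasurable fun ω : ℝ =>
        angularFT g (ω + 2 * Real.pi / T * ((m : ℕ) - M)) := hG.comp_measurable (by fun_prop)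
    have he : StronglyMeasurable fun ω : ℝ =>
        exp (I * ((ω * (l : ℕ) * T / (2 * M : ℕ) : ℝ) : ℂ)) * ((1 / T : ℝ) : ℂ) :=
      Continuous.stronglyMeasurable (by fun_prop)
    exact ((he.mul hs').mul hg').mul stronglyMeasurable_const
  · filter_upwards [h1, h2] with ω h1 h2
    simp only [correctionMatrix, Matrix.of_apply, norm_mul, norm_exp_I_mul, RCLike.norm_conj,
      one_mul, mul_one, Complex.norm_real, Real.norm_eq_abs, abs_of_pos (one_div_pos.2 hT)]
    have hb' : 0 ≤ b' := (norm_nonneg _).trans (h2 m).2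
    refine mul_le_mul_of_nonneg_right ?_ (norm_nonneg _)
    have := (one_div_pos.2 hT).le
    gcongr
    · exact (h2 m).2
    · exact (h1 m).2

/-- The filtered output, expressed by the spectra. -/
theorem filterOutput_output (H : ParametricSystem) (g s : Signal) (T : ℝ) {N : ℕ} (x : Fin N → ℂ)
    (t : ℝ) :
    filterOutput s (H.output g T x) t = ((1 / (2 * Real.pi) : ℝ) : ℂ) *
      ∫ ω : ℝ, ∑ i, ∑ n : Fin N, H.pulseCoeff T x i n *
        (exp (I * ((ω * (t - (H.τ i + (n : ℕ) * T)) : ℝ) : ℂ)) *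
          (angularFT g ω * conj (angularFT s ω))) := by
  have hint : ∀ i (n : Fin N), Integrable fun u =>
      H.pulseCoeff T x i n * (g (u - (H.τ i + (n : ℕ) * T)) * conj (s (u - t))) := by
    intro i n
    refine Integrable.const_mul ?_ _
    exact ((Lp.memLp g).comp_measurePreserving (measurePreserving_sub_const _)).integrable_mul
      ((Lp.memLp s).comp_measurePreserving (measurePreserving_sub_const t)).star
  have hint' : ∀ i (n : Fin N), Integrable fun ω : ℝ => H.pulseCoeff T x i n *
        (exp (I * ((ω * (t - (H.τ i + (n : ℕ) * T)) : ℝ) : ℂ)) *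
          (angularFT g ω * conj (angularFT s ω))) :=
    fun i n => (integrable_exp_mul_angularFT g s _).const_mul _
  have hdist : ∀ u, H.output g T x u * conj (s (u - t)) = ∑ i, ∑ n : Fin N,
      H.pulseCoeff T x i n * (g (u - (H.τ i + (n : ℕ) * T)) * conj (s (u - t))) := by
    intro u
    simp only [ParametricSystem.output, Finset.sum_mul, sub_sub, mul_assoc]
  unfold filterOutput
  simp_rw [hdist]
  rw [integral_finsetSum _ fun i _ => integrable_finsetSum _ fun n _ => hint i n,
    integral_finsetSum _ fun i _ => integrable_finsetSum _ fun n _ => hint' i n, Finset.mul_sum]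
  refine Finset.sum_congr rfl fun i _ => ?_
  rw [integral_finsetSum _ fun n _ => hint i n, integral_finsetSum _ fun n _ => hint' i n,
    Finset.mul_sum]
  refine Finset.sum_congr rfl fun n _ => ?_
  rw [integral_const_mul, integral_const_mul, integral_translate_mul_conj_translate]
  ring

/-- The sampled channels are the inverse transforms of the aliased spectrum `W(ω) d(ω)`. -/
theorem channel_eq_idtft (H : ParametricSystem) {g s : Signal} {W T : ℝ} (hW : 0 < W)
    (hT : T = 4 * Real.pi * H.Kτ / W) (hs : IsLowPass s T H.Kτ) {N : ℕ}
    (x : Fin N → ℂ) (l : Fin (2 * H.Kτ)) (n : ℤ) :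
    channel s W H.Kτ (H.output g T x) l n =
      idtft T (fun ω => (correctionMatrix g s T H.Kτ ω).mulVec (H.modifiedSpectrum T x ω) l) n := by
  have hM : (0 : ℝ) < H.Kτ := by exact_mod_cast H.Kτ_pos
  have hT0 : 0 < T := by rw [hT]; positivity
  have hP : 0 < 2 * Real.pi / T := by positivity
  -- the sampling instant
  have ht : 2 * Real.pi * ((n * (2 * H.Kτ : ℕ) + (l : ℕ) : ℤ) : ℝ) / W = n * T + l * T / (2 * H.Kτ) := by
    rw [hT]; push_cast; field_simp; ring
  unfold channel
  rw [ht, filterOutput_output, integral_fold hP H.Kτ]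
  · unfold idtft
    rw [show ((1 / (2 * Real.pi) : ℝ) : ℂ) = ((T / (2 * Real.pi) : ℝ) : ℂ) * ((1 / T : ℝ) : ℂ) by
      rw [← Complex.ofReal_mul]; congr 1; field_simp, mul_assoc, ← integral_const_mul]
    congr 1
    refine integral_congr_ae (ae_of_all _ fun ω => ?_)
    simp only [Matrix.mulVec, dotProduct, Finset.mul_sum, Finset.sum_mul]
    refine Finset.sum_congr rfl fun m _ => ?_
    simp only [ParametricSystem.modifiedSpectrum, ParametricSystem.pathSpectrum,
      ParametricSystem.pulseSpectrum, Finset.mul_sum, Finset.sum_mul, delayNode_zpow]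
    refine Finset.sum_congr rfl fun i _ => Finset.sum_congr rfl fun k _ => ?_
    simp only [correctionMatrix, Matrix.of_apply]
    set G := angularFT g (ω + 2 * Real.pi / T * ((m : ℕ) - H.Kτ))
    set S := angularFT s (ω + 2 * Real.pi / T * ((m : ℕ) - H.Kτ))
    set a := H.pulseCoeff T x i k
    -- the two phases differ by a multiple of `2π`
    have hphase : exp (I * (((ω + 2 * Real.pi / T * ((m : ℕ) - H.Kτ)) *
          (n * T + l * T / (2 * H.Kτ) - (H.τ i + (k : ℕ) * T)) : ℝ) : ℂ)) =
        exp (I * ((ω * (l : ℕ) * T / (2 * H.Kτ : ℕ) : ℝ) : ℂ)) *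
        exp (I * ((2 * Real.pi / (2 * H.Kτ : ℕ) * (l : ℕ) * ((m : ℕ) - H.Kτ) : ℝ) : ℂ)) *
        exp (-I * ((2 * Real.pi / T * (((m : ℤ) - (H.Kτ : ℤ) : ℤ) : ℝ) * H.τ i : ℝ) : ℂ)) *
        exp (-I * ((ω * H.τ i : ℝ) : ℂ)) *
        exp (-I * ((ω * (k : ℕ) * T : ℝ) : ℂ)) *
        exp (I * ((ω * n * T : ℝ) : ℂ)) := by
      simp only [← Complex.exp_add]
      rw [Complex.exp_eq_exp_iff_exists_int]
      refine ⟨((m : ℤ) - H.Kτ) * (n - k), ?_⟩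
      have hT' : (T : ℂ) ≠ 0 := by exact_mod_cast hT0.ne'
      have hM' : (H.Kτ : ℂ) ≠ 0 := by exact_mod_cast hM.ne'
      push_cast
      field_simp
      ring
    rw [hphase]
    ring
  · exact integrable_finsetSum _ fun i _ => integrable_finsetSum _ fun k _ =>
      (integrable_exp_mul_angularFT g s _).const_mul _
  · filter_upwards [hs.1] with ω hω hmem
    rw [← workingBand_eq] at hmem
    simp [hω hmem]

/-! ### Identification of the system -/

theorem pulseCoeff_eq (H : ParametricSystem) (T : ℝ) {N : ℕ} (x : Fin N → ℂ) (i : Fin H.Kτ)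
    (n : Fin N) : H.pulseCoeff T x i n =
      x n * ∑ j, H.α i j * exp (I * ((2 * Real.pi * H.ν i j * T : ℝ) : ℂ)) ^ (n : ℕ) := by
  rw [ParametricSystem.pulseCoeff, Finset.mul_sum]
  refine Finset.sum_congr rfl fun j _ => ?_
  rw [← Complex.exp_nat_mul]
  rw [show I * ((2 * Real.pi * H.ν i j * (n : ℕ) * T : ℝ) : ℂ) =
    (n : ℕ) * (I * ((2 * Real.pi * H.ν i j * T : ℝ) : ℂ)) by push_cast; ring]
  ring

/-- No path is silent: with at least as many pulses as Doppler-shifts, the pulse coefficients of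
a path do not all vanish. -/
theorem exists_pulseCoeff_ne_zero (H : ParametricSystem) {T : ℝ} (hT : 0 < T) {N : ℕ}
    {x : Fin N → ℂ} (hx : ∀ n, x n ≠ 0) (i : Fin H.Kτ) (hN : H.Kν i ≤ N)
    (hν : ∀ j, |H.ν i j * T| < 1 / 2) : ∃ n, H.pulseCoeff T x i n ≠ 0 := by
  by_contra! hzero
  have hw : Function.Injective fun j => exp (I * ((2 * Real.pi * H.ν i j * T : ℝ) : ℂ)) := by
    intro j j' h
    refine H.ν_injective i ?_
    rw [← arg_exp_div_eq hT (hν j), ← arg_exp_div_eq hT (hν j')]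
    exact congrArg (fun z => arg z / (2 * Real.pi * T)) h
  have h0 : H.α i = 0 := eq_zero_of_sum_mul_pow_eq_zero hw fun n hn => by
    have := hzero ⟨n, by omega⟩
    rw [pulseCoeff_eq] at this
    exact (mul_eq_zero.1 this).resolve_left (hx _)
  exact H.α_ne_zero i ⟨0, H.Kν_pos i⟩ (congrFun h0 _)

/-- Every path has a Doppler-shift, so `K ≥ max_i Kν,i + Kτ - 1`; then apply the
arithmetic–geometric mean inequality. -/
theorem four_mul_Kτ_mul_KνMax_le (H : ParametricSystem) :
    4 * (H.Kτ * H.KνMax) ≤ (H.K + 1) ^ 2 := by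
  have : Nonempty (Fin H.Kτ) := ⟨⟨0, H.Kτ_pos⟩⟩
  obtain ⟨i, -, hi⟩ := Finset.exists_mem_eq_sup (Finset.univ : Finset (Fin H.Kτ))
    Finset.univ_nonempty H.Kν
  have h1 : H.KνMax + H.Kτ ≤ H.K + 1 := by
    have h2 : H.Kτ - 1 ≤ ∑ k ∈ Finset.univ.erase i, H.Kν k := by
      have := Finset.card_nsmul_le_sum (Finset.univ.erase i) H.Kν 1 fun k _ => H.Kν_pos k
      simpa [Finset.card_erase_of_mem] using this
    have h3 := Finset.add_sum_erase Finset.univ H.Kν (Finset.mem_univ i)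
    have h4 := H.Kτ_pos
    unfold ParametricSystem.KνMax ParametricSystem.K
    rw [hi]
    omega
  nlinarith [Nat.pow_le_pow_left h1 2, four_mul_le_sq_add H.KνMax H.Kτ]

/-- The spectra `d(ω) = W(ω)⁻¹ c(ω)` computed from the channels are the noiseless modified
measurements. -/
theorem correctedSpectrum_ae_eq (H : ParametricSystem) {g s : Signal} {W T : ℝ} (hW : 0 < W)
    (hT : T = 4 * Real.pi * H.Kτ / W) (hT0 : 0 < T) (hg : BoundedOnBand g T H.Kτ)
    (hs : IsLowPass s T H.Kτ) {N : ℕ} (x : Fin N → ℂ) {C : Fin (2 * H.Kτ) → ℝ → ℂ}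
    (hC : ∀ l, IsDTFT T (channel s W H.Kτ (H.output g T x) l) (C l)) :
    ∀ᵐ ω ∂(volume.restrict (Set.Ioo 0 (2 * Real.pi / T))),
      correctedSpectrum g s T H.Kτ C ω = H.modifiedSpectrum T x ω := by
  have hae : ∀ l, C l =ᵐ[volume.restrict (Set.Ioo 0 (2 * Real.pi / T))]
      fun ω => (correctionMatrix g s T H.Kτ ω).mulVec (H.modifiedSpectrum T x ω) l := fun l =>
    ae_eq_of_idtft_eq hT0 (hC l).1
      (memLp_correctionMatrix_mulVec hT0 hg hs.2
        ParametricSystem.continuous_modifiedSpectrum l)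
      fun n => ((hC l).2 n).symm.trans (channel_eq_idtft H hW hT hs x l n)
  filter_upwards [ae_all_iff.2 hae, ae_isUnit_det_correctionMatrix hT0 hg hs.2] with ω h1 h2
  rw [correctedSpectrum, show (fun l => C l ω) =
    (correctionMatrix g s T H.Kτ ω).mulVec (H.modifiedSpectrum T x ω) from funext h1,
    Matrix.mulVec_mulVec, Matrix.nonsing_inv_mul _ h2, Matrix.one_mulVec]

theorem idtft_modifiedSpectrum (H : ParametricSystem) (T : ℝ) {N : ℕ} (x : Fin N → ℂ)
    (m : Fin (2 * H.Kτ)) (n : ℤ) :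
    idtft T (fun ω => H.modifiedSpectrum T x ω m) n =
      ∑ i, delayNode T (H.τ i) ^ ((m : ℤ) - H.Kτ) * idtft T (H.pathSpectrum T x i) n :=
  idtft_fun_sum _ (fun i _ =>
    (ParametricSystem.continuous_pathSpectrum i).integrableOn_Icc.mono_set
      Set.Ioo_subset_Icc_self) _ _

/-- Delaying a path multiplies its spectrum by a phase, so it cannot make the path vanish. -/
theorem exists_idtft_pathSpectrum_ne_zero (H : ParametricSystem) {T : ℝ} (hT : 0 < T) {N : ℕ}
    {x : Fin N → ℂ} {i : Fin H.Kτ} (h : ∃ n, H.pulseCoeff T x i n ≠ 0) :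
    ∃ n, idtft T (H.pathSpectrum T x i) n ≠ 0 := by
  by_contra! hzero
  obtain ⟨n, hn⟩ := h
  have h0 : ∀ n, idtft T (fun _ => 0) n = 0 := fun n => by simp [idtft]
  have h1 := ae_eq_of_idtft_eq hT ((ParametricSystem.continuous_pathSpectrum i).memLp_Ioo _ _)
    (continuous_const.memLp_Ioo 0 _) fun n => (hzero n).trans (h0 n).symm
  have h2 : H.pulseSpectrum T x i =ᵐ[volume.restrict (Set.Ioo 0 (2 * Real.pi / T))]
      fun _ => 0 := by
    filter_upwards [h1] with ω hω
    exact (mul_eq_zero.1 hω).resolve_left (exp_ne_zero _)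
  refine hn ?_
  rw [← idtft_trigPoly hT (H.pulseCoeff T x i) n]
  exact (idtft_congr_ae h2 _).trans (h0 _)

theorem delayMatrix_apply (T : ℝ) (M : ℕ) {r : ℕ} (τ : Fin r → ℝ) (m : Fin (2 * M)) (i : Fin r) :
    delayMatrix T M τ m i = delayNode T (τ i) ^ ((m : ℤ) - M) := by
  rw [delayNode_zpow, delayMatrix, Matrix.of_apply]
  push_cast
  rfl

theorem delayMatrix_mulVec_injective {T : ℝ} (hT : 0 < T) {M r : ℕ} {τ : Fin r → ℝ}
    (hr : r ≤ 2 * M) (hτ : Function.Injective τ) (hmem : ∀ i, τ i ∈ Set.Ico 0 T) :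
    Function.Injective (delayMatrix T M τ).mulVec := by
  rw [← Matrix.coe_mulVecLin, ← LinearMap.ker_eq_bot, LinearMap.ker_eq_bot']
  intro v hv
  have h0 : ∀ i, delayNode T (τ i) ≠ 0 := fun i => exp_ne_zero _
  have h1 : (fun i => delayNode T (τ i) ^ (-(M : ℤ)) * v i) = 0 := by
    refine eq_zero_of_sum_mul_pow_eq_zero (exp_delay_injective hT hτ hmem) fun m hm => ?_
    have h2 := congrFun hv ⟨m, by omega⟩
    rw [Matrix.mulVecLin_apply] at h2
    simp only [Matrix.mulVec, dotProduct, delayMatrix_apply, Pi.zero_apply] at h2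
    rw [← h2]
    refine Finset.sum_congr rfl fun i _ => ?_
    rw [sub_eq_add_neg, zpow_add₀ (h0 i), zpow_natCast, delayNode]
    ring
  funext i
  simpa [h0 i] using congrFun h1 i

/-- Once the delays are known up to order, inverting the Vandermonde matrix and undoing the
delays recovers the pulse coefficients of every path. -/
theorem recoveredCoeff_eq (H : ParametricSystem) {T : ℝ} (hT : 0 < T)
    (hmem : ∀ i, H.τ i ∈ Set.Ico 0 T) {N : ℕ} {x : Fin N → ℂ} {D : ℝ → Fin (2 * H.Kτ) → ℂ}
    (hD : ∀ᵐ ω ∂(volume.restrict (Set.Ioo 0 (2 * Real.pi / T))),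
      D ω = H.modifiedSpectrum T x ω) {r : ℕ} (e : Fin r ≃ Fin H.Kτ)
    {P : Matrix (Fin r) (Fin (2 * H.Kτ)) ℂ}
    (hP : IsMoorePenrose (delayMatrix T H.Kτ (H.τ ∘ e)) P) (i : Fin r) (n : Fin N) :
    recoveredCoeff T H.Kτ D (H.τ ∘ e) P i ((n : ℕ) : ℤ) = H.pulseCoeff T x (e i) n := by
  have hr : r ≤ 2 * H.Kτ := by
    have : r = H.Kτ := by simpa using Fintype.card_congr e
    omega
  obtain ⟨Q, -, hQ⟩ := exists_isMoorePenrose (delayMatrix_mulVec_injective (M := H.Kτ) hT hr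
    (H.τ_injective.comp e.injective) fun i => hmem (e i))
  have hPN := hP.mul_eq_one hQ
  rw [← idtft_trigPoly hT (H.pulseCoeff T x (e i)) n]
  refine idtft_congr_ae ?_ _
  filter_upwards [hD] with ω hω
  have h1 : D ω = (delayMatrix T H.Kτ (H.τ ∘ e)).mulVec fun k => H.pathSpectrum T x (e k) ω := by
    rw [hω]
    funext m
    rw [ParametricSystem.modifiedSpectrum, Matrix.mulVec, dotProduct, ← Equiv.sum_comp e]
    exact Finset.sum_congr rfl fun k _ => by rw [delayMatrix_apply]; rfl
  rw [h1, Matrix.mulVec_mulVec, hPN, Matrix.one_mulVec, ParametricSystem.pathSpectrum, ← mul_assoc,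
    ← Complex.exp_add, Function.comp_apply, neg_mul, add_neg_cancel, Complex.exp_zero, one_mul]
  rfl

/-- The runs of the procedure on the output of `H` are exactly those that return the triplets
of `H`, provided there are at least `2 max_i Kν,i` pulses. -/
theorem procedureReturns_output_iff (H : ParametricSystem) {W T : ℝ} (hW : 0 < W)
    (hT : T = 4 * Real.pi * H.Kτ / W) (hT0 : 0 < T) {g s : Signal} (hg : BoundedOnBand g T H.Kτ)
    (hs : IsLowPass s T H.Kτ) {N : ℕ} (hN : ∀ i, 2 * H.Kν i ≤ N) {x : Fin N → ℂ}
    (hx : ∀ n, x n ≠ 0) (hmem : ∀ i, H.τ i ∈ Set.Ico 0 T) (hν : ∀ i j, |H.ν i j * T| < 1 / 2)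
    (S : Set (ℝ × ℝ × ℂ)) :
    ProcedureReturns g s W T H.Kτ x (H.output g T x) S ↔ S = H.triplets := by
  -- each stage returns the true parameters up to order, for every version of the spectra
  have hdelay : ∀ {C : Fin (2 * H.Kτ) → ℝ → ℂ},
      (∀ l, IsDTFT T (channel s W H.Kτ (H.output g T x) l) (C l)) → ∀ {r : ℕ} (τ : Fin r → ℝ),
      IsDelayEstimate T H.Kτ
        (fun l n => idtft T (fun ω => correctedSpectrum g s T H.Kτ C ω l) n) r τ ↔
      ∃ e : Fin r ≃ Fin H.Kτ, τ = H.τ ∘ e := by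
    intro C hC r τ
    have hD := correctedSpectrum_ae_eq H hW hT hT0 hg hs x hC
    refine isDelayEstimate_iff hT0 H.τ_injective hmem
      (b := fun i n => idtft T (H.pathSpectrum T x i) n)
      (fun i => summable_sq_idtft hT0
        ((ParametricSystem.continuous_pathSpectrum i).memLp_Ioo _ _))
      (fun i => exists_idtft_pathSpectrum_ne_zero H hT0
        (exists_pulseCoeff_ne_zero H hT0 hx i (by have := hN i; omega) (hν i)))
      (fun l n => ?_) τ
    refine (idtft_congr_ae (B := fun ω => H.modifiedSpectrum T x ω l) ?_ n).trans
      (idtft_modifiedSpectrum H T x l n)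
    filter_upwards [hD] with ω hω
    rw [hω]
  have hdoppler : ∀ {C : Fin (2 * H.Kτ) → ℝ → ℂ},
      (∀ l, IsDTFT T (channel s W H.Kτ (H.output g T x) l) (C l)) →
      ∀ {r : ℕ} (e : Fin r ≃ Fin H.Kτ) {P : Matrix (Fin r) (Fin (2 * H.Kτ)) ℂ},
      IsMoorePenrose (delayMatrix T H.Kτ (H.τ ∘ e)) P →
      ∀ i {L : ℕ} (ν : Fin L → ℝ) (α : Fin L → ℂ),
      IsDopplerEstimate T (fun n : Fin N => recoveredCoeff T H.Kτ
        (correctedSpectrum g s T H.Kτ C) (H.τ ∘ e) P i ((n : ℕ) : ℤ) / x n) L ν α ↔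
      ∃ e' : Fin L ≃ Fin (H.Kν (e i)), ν = H.ν (e i) ∘ e' ∧ α = H.α (e i) ∘ e' := by
    intro C hC r e P hP i L ν α
    refine isDopplerEstimate_iff hT0 (hN _) (H.ν_injective _) (hν _) (H.α_ne_zero _) (fun n => ?_)
      ν α
    rw [recoveredCoeff_eq H hT0 hmem (correctedSpectrum_ae_eq H hW hT hT0 hg hs x hC) e hP,
      pulseCoeff_eq, mul_div_cancel_left₀ _ (hx n)]
  constructor
  · rintro ⟨C, hC, r, τ, hτ, P, hP, L, ν, α, hνα, rfl⟩
    obtain ⟨e, rfl⟩ := (hdelay hC τ).1 hτ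
    choose e' hν' hα' using fun i => (hdoppler hC e hP i _ _).1 (hνα i)
    ext q
    constructor
    · rintro ⟨i, j, rfl⟩
      exact ⟨e i, e' i j, by rw [hν', hα']; rfl⟩
    · rintro ⟨i, j, rfl⟩
      obtain ⟨i, rfl⟩ := e.surjective i
      obtain ⟨j, rfl⟩ := (e' i).surjective j
      exact ⟨i, j, by rw [hν', hα']; rfl⟩
  · rintro rfl
    have hC : ∀ l, IsDTFT T (channel s W H.Kτ (H.output g T x) l)
        (fun ω => (correctionMatrix g s T H.Kτ ω).mulVec (H.modifiedSpectrum T x ω) l) := fun l =>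
      ⟨memLp_correctionMatrix_mulVec hT0 hg hs.2 ParametricSystem.continuous_modifiedSpectrum l,
        fun n => channel_eq_idtft H hW hT hs x l n⟩
    obtain ⟨P, hP, -⟩ := exists_isMoorePenrose (delayMatrix_mulVec_injective (M := H.Kτ) hT0
      (by omega) H.τ_injective hmem)
    refine ⟨_, hC, H.Kτ, H.τ, (hdelay hC _).2 ⟨Equiv.refl _, rfl⟩, P, hP, H.Kν, H.ν, H.α,
      fun i => ?_, rfl⟩
    exact (hdoppler hC (Equiv.refl _) hP i _ _).2 ⟨Equiv.refl _, rfl, rfl⟩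

theorem corollary1
    -- the system, its delay spread and its Doppler spread
    (H : ParametricSystem) (τmax νmax : ℝ)
    -- the temporal support and the bandwidth of the input signal; the pulse period and the
    -- number of pulses, chosen so that there are `2 Kτ` sampling channels
    (Tsupp W T : ℝ) (N : ℕ)
    (hW : 0 < W)
    (hT : T = 4 * Real.pi * H.Kτ / W)
    (hN : N = ⌊Tsupp / T⌋₊)
    -- the pulse, the low-pass filter and the probing sequence
    (g s : Signal) (hg : IsPulse g W T H.Kτ) (hs : IsLowPass s T H.Kτ)
    (x : Fin N → ℂ) (hx : ∀ n, 0 < ‖x n‖)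
    -- the assumptions on the footprint of the system
    (hA1 : H.InRectangle τmax νmax)
    (hA2 : τmax < T)
    (hA3 : νmax * T < 1)
    -- the condition on the time–bandwidth product
    (hTW : 2 * Real.pi * ((H.K : ℝ) + 1) ^ 2 ≤ Tsupp * W) :
    (H.Kτ : ℝ) * H.KνMax ≤ ((H.K : ℝ) + 1) ^ 2 / 4 ∧
    ∀ S : Set (ℝ × ℝ × ℂ),
      ProcedureReturns g s W T H.Kτ x (H.output g T x) S ↔ S = H.triplets := by
  have hbound : (H.Kτ : ℝ) * H.KνMax ≤ ((H.K : ℝ) + 1) ^ 2 / 4 := by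
    have : ((4 * (H.Kτ * H.KνMax) : ℕ) : ℝ) ≤ (((H.K + 1) ^ 2 : ℕ) : ℝ) :=
      Nat.cast_le.2 (four_mul_Kτ_mul_KνMax_le H)
    push_cast at this
    linarith
  have hM : (0 : ℝ) < H.Kτ := by exact_mod_cast H.Kτ_pos
  have hpi := Real.pi_pos
  have hT0 : 0 < T := by rw [hT]; positivity
  -- the time–bandwidth product leaves room for at least `2 max_i Kν,i` pulses
  have hNmax : 2 * H.KνMax ≤ N := by
    rw [hN]
    refine Nat.le_floor ?_
    rw [le_div_iff₀ hT0, hT, ← mul_div_assoc, div_le_iff₀ hW]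
    push_cast
    nlinarith
  refine ⟨hbound, procedureReturns_output_iff H hW hT hT0 hg.2.2 hs (fun i => ?_)
    (fun n => norm_pos_iff.1 (hx n)) (fun i => ?_) (fun i j => ?_)⟩
  · have : H.Kν i ≤ H.KνMax := Finset.le_sup (f := H.Kν) (Finset.mem_univ i)
    omega
  · have h := (hA1 i ⟨0, H.Kν_pos i⟩).1
    exact ⟨h.1, h.2.trans_lt hA2⟩
  · obtain ⟨h1, h2⟩ := (hA1 i j).2
    rw [abs_lt]
    constructor <;> nlinarith
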